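/- Let $n\ge 1$, $J=I_{1,n-1}=\mathrm{diag}(\epsilon_1,\dots,\epsilon_n)=\mathrm{diag}(-1,1,\dots,1)$, $O(1,n-1)=\{A\in GL_n(\mathbb R): A^tJA=J\}$, let $U\subset\mathbb R^n$ be open with coordinates $x_1,\dots,x_n$, and let $A=(a^k_i)\colon U\to O(1,n-1)$ be smooth ($k$ is the row, $i$ the column). All functions are smooth. Consider $$\mathrm I=\sum_{i=1}^n\epsilon_i(a^1_i)^2dx_i\otimes dx_i,\qquad \mathrm{II}=\sum_{\lambda=2}^n\sum_{i=1}^n\epsilon_ia^1_ia^\lambda_i\,dx_i\otimes dx_i\;e_{n+\lambda-1}.\tag{1}$$ *Gauss–Codazzi and structure equations.* Put $\omega^i=a^1_idx_i$ and $\omega^{n+\lambda-1}_i=\epsilon_ia^\lambda_idx_i=-\epsilon_i\omega^i_{n+\lambda-1}$. A matrix of 1-forms $u=(\omega^i_j)=\sum_k u_k\,dx_k$ satisfies the Gauss–Codazzi and structure equations of (1) (with respect to a parallel orthonormal normal frame) if $$d\omega^i=\sum_j\omega^j\wedge\omega^i_j,\qquad \epsilon_i\omega^i_j+\epsilon_j\omega^j_i=0,\qquad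 d\omega^i_j+\sum_k\omega^i_k\wedge\omega^k_j+\sum_{\lambda}\omega^i_{n+\lambda-1}\wedge\omega^{n+\lambda-1}_j=0,$$ $$d\omega^{n+\lambda-1}_i+\sum_j\omega^{n+\lambda-1}_j\wedge\omega^j_i=0,\qquad \sum_j\omega^{n+\lambda-1}_j\wedge\omega^j_{n+\mu-1}=0\qquad(2\le\lambda,\mu\le n).$$ *Twisted system.* Let $\tilde J=\mathrm{diag}(J,-J)$, $\sigma_0(y)=I_{n,n}yI_{n,n}^{-1}$, $\sigma_1(y)=I_{n+1,n-1}yI_{n+1,n-1}^{-1}$, where $I_{p,q}$ has $p$ diagonal entries $-1$ followed by $q$ entries $1$, let $K_0'=\{\mathrm{diag}(I_n,C):C\in O(1,n-1)\}$ and fix $0<\varepsilon<1$. Let $L^{\sigma_0}_-$ be the group of holomorphic maps $f$ from $\{|z|>\varepsilon\}\cup\{\infty\}$ to $GL_{2n}(\mathbb C)$ with $f(\infty)\in K_0'$ and, for $\varepsilon<|z|<1/\varepsilon$, $f(\bar z)^*\tilde Jf(z)=\tilde J$, $\overline{f(\bar z)}=f(z)$, $\sigma_0(f(-z))=f(z)$.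 For a loop $\xi(z)=\sum_{j\le N}\xi_jz^j$ let $$\hat\pi_+(\xi)=\pi_{\mathcal S_0}(\xi_0)-\pi_{\mathcal S_1}\Big(\sum_{0<j\le N,\ j\text{ even}}(\xi_j+\sigma_1(\xi_j))\Big)+\sum_{0<j\le N}\big(\xi_jz^j+\sigma_1(\xi_j)z^{-j}\big),$$ where $\pi_{\mathcal S_0}$ keeps the upper left $n\times n$ block and $\pi_{\mathcal S_1}$ the lower right $(n-1)\times(n-1)$ block. Put $a_i=\frac12\begin{pmatrix}0&e_i\\e_i&0\end{pmatrix}$ with $e_i$ the $i$-th diagonal matrix unit, $J_{a_i,1}=a_iz+\sigma_1(a_i)z^{-1}$, $b^{-1}=\mathrm{diag}(I_n,A^t)$. For $u=\sum_iu_idx_i$, the pair $(A,u)$ solves the 1-dimensional twisted $\frac{O(J,J)}{O(J)\times O(J)}$-system (twisted by $\sigma_1$) if the $u_i$ take values in $o(1,n-1)$ and there is $M=M(x,z)$, smooth in $x$ with $M(x,\cdot)\in L^{\sigma_0}_-$ for $x\in U$, such that, for all $i,j$ and $\varepsilon<|z|<1/\varepsilon$, $$\hat\pi_+(MJ_{a_i,1}M^{-1})=ba_ib^{-1}z+\begin{pmatrix}u_i&0\\0&0\end{pmatrix}+\sigma_1(ba_ib^{-1})z^{-1},$$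 $$\big[\partial_{x_i}+\hat\pi_+(MJ_{a_i,1}M^{-1}),\ \partial_{x_j}+\hat\pi_+(MJ_{a_j,1}M^{-1})\big]=0 .$$ *Generalized sinh-Gordon equation* for $A$ and $F=(f_{ij})$, $1\le i,j,k\le n$: $$A\in O(1,n-1);\qquad f_{ii}=0,\quad \partial_{x_j}a^k_i=a^k_jf_{ij}\ (i\ne j);\qquad \partial_{x_k}f_{ij}=f_{ik}f_{kj}\ (i,j,k\text{ distinct});$$ $$\epsilon_j\partial_{x_j}f_{ij}+\epsilon_i\partial_{x_i}f_{ji}+\sum_{k\ne i,j}\epsilon_kf_{ik}f_{jk}=-a^1_ia^1_j\quad(i\ne j).$$ **Theorem.** With $\delta=\mathrm{diag}(dx_1,\dots,dx_n)$: 1. If $X\colon U\to\mathbb R^{2n-1}_1$ is a coordinate parametrization of a time-like $n$-dimensional submanifold of constant sectional curvature $1$ with orthonormal parallel normal frame $e_{n+1},\dots,e_{2n-1}$ and fundamental forms (1), and $\omega$ is its Levi-Civita connection matrix in the tangent frame $\partial_{x_i}X/a^1_i$, then $\omega$ satisfies the Gauss–Codazzi and structure equations of (1), $(A,\omega)$ solves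 the 1-dimensional twisted system, and there is $F$ such that $(A,F)$ solves the generalized sinh-Gordon equation and $\omega=\delta F-JF^t\delta J$. 2. If $a^1_i\neq0$ on $U$ for all $i$ (that is, $\mathrm I$ is nondegenerate), then for every $u$: $u$ satisfies the Gauss–Codazzi and structure equations of (1) if and only if $(A,u)$ solves the 1-dimensional twisted system. 3. For every $u$, $(A,u)$ solves the 1-dimensional twisted system if and only if there is $F$ such that $(A,F)$ solves the generalized sinh-Gordon equation and $u=\delta F-JF^t\delta J$. In particular the 1-dimensional twisted system is solvable for $A$ (by some $u$) if and only if $A$ satisfies the generalized sinh-Gordon equation (with some $F$). -/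

import Mathlib

open scoped ContDiff Matrix

noncomputable section

namespace SinhG

/-! ## Partial derivatives and differential forms on a domain of coordinate space -/

/-- Coordinate space with coordinates `x_i`. -/
abbrev Coord (n : ℕ) : Type := Fin n → ℝ

/-- The partial derivative `∂ f / ∂ x_i`. -/
def pd {n : ℕ} {F : Type*} [NormedAddCommGroup F] [NormedSpace ℝ F]
    (i : Fin n) (f : Coord n → F) (x : Coord n) : F :=
  fderiv ℝ f x (Pi.single i 1)

/-- The entrywise partial derivative of a matrix-valued function. -/
def pdMat {n : ℕ} {ι F : Type*} [NormedAddCommGroup F] [NormedSpace ℝ F]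
    (i : Fin n) (T : Coord n → Matrix ι ι F) (x : Coord n) : Matrix ι ι F :=
  Matrix.of fun p q => pd i (fun y => T y p q) x

/-- A matrix-valued function is smooth on `U`. -/
def SmoothMat {n : ℕ} {ι F : Type*} [NormedAddCommGroup F] [NormedSpace ℝ F]
    (U : Set (Coord n)) (T : Coord n → Matrix ι ι F) : Prop :=
  ∀ p q, ContDiffOn ℝ ∞ (fun x => T x p q) U

/-- Real 1-forms; `α x k` is the coefficient of `dx_k` at `x`. -/
abbrev OneForm (n : ℕ) : Type := Coord n → Fin n → ℝ

/-- The exterior derivative: `(dα)(∂_k, ∂_l)`. -/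
def extD {n : ℕ} (α : OneForm n) (x : Coord n) (k l : Fin n) : ℝ :=
  pd k (fun y => α y l) x - pd l (fun y => α y k) x

/-- The wedge product: `(α ∧ β)(∂_k, ∂_l)`. -/
def wedge {n : ℕ} (α β : OneForm n) (x : Coord n) (k l : Fin n) : ℝ :=
  α x k * β x l - α x l * β x k

/-! ## The groups, the involutions and the loops -/

/-- The signs `ε_1 = -1`, `ε_i = 1` for `i > 1` (the first index is `0 : Fin n`). -/
def eps (R : Type*) [CommRing R] {n : ℕ} (i : Fin n) : R := if (i : ℕ) = 0 then -1 else 1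

/-- `J = I_{1,n-1} = diag(-1, 1, …, 1)`. -/
def J (n : ℕ) (R : Type*) [CommRing R] : Matrix (Fin n) (Fin n) R := Matrix.diagonal (eps R)

/-- The group `O(1,n-1)`, as a set of matrices. -/
def O1 (n : ℕ) : Set (Matrix (Fin n) (Fin n) ℝ) := {A | Aᵀ * J n ℝ * A = J n ℝ}

/-- The Lie algebra `o(1,n-1)`. -/
def o1 (n : ℕ) : Set (Matrix (Fin n) (Fin n) ℝ) := {u | uᵀ * J n ℝ + J n ℝ * u = 0}

/-- Matrices of size `2n`, in `n + n` block form. -/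
abbrev Mat2 (n : ℕ) (R : Type*) : Type _ := Matrix (Fin n ⊕ Fin n) (Fin n ⊕ Fin n) R

/-- `J̃ = diag(J, -J)`, the form that defines `O(J,J)`. -/
def Jt (n : ℕ) (R : Type*) [CommRing R] : Mat2 n R :=
  Matrix.fromBlocks (J n R) 0 0 (-(J n R))

/-- `I_{n,n}`. -/
def I0 (n : ℕ) (R : Type*) [CommRing R] : Mat2 n R := Matrix.fromBlocks (-1) 0 0 1

/-- `I_{n+1,n-1}`: the first `n + 1` diagonal entries are `-1`, the others are `1`. -/
def I1 (n : ℕ) (R : Type*) [CommRing R] : Mat2 n R := Matrix.fromBlocks (-1) 0 0 (J n R)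

/-- The involution `σ_0`. -/
def sigma0 {n : ℕ} {R : Type*} [CommRing R] (x : Mat2 n R) : Mat2 n R :=
  I0 n R * x * (I0 n R)⁻¹

/-- The involution `σ_1`. -/
def sigma1 {n : ℕ} {R : Type*} [CommRing R] (x : Mat2 n R) : Mat2 n R :=
  I1 n R * x * (I1 n R)⁻¹

/-- The projection to `𝒮_0 = o(1,n-1) ⊕ 0_n`: keep the upper left `n × n` block. -/
def piS0 {n : ℕ} {R : Type*} [CommRing R] (x : Mat2 n R) : Mat2 n R :=
  Matrix.fromBlocks x.toBlocks₁₁ 0 0 0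

/-- The projection to `𝒮_1 = 0_{n+1} ⊕ o(n-1)`: keep the lower right `(n-1) × (n-1)` block. -/
def piS1 {n : ℕ} {R : Type*} [CommRing R] (x : Mat2 n R) : Mat2 n R :=
  Matrix.fromBlocks 0 0 0
    (Matrix.of fun i j => if (i : ℕ) = 0 ∨ (j : ℕ) = 0 then 0 else x.toBlocks₂₂ i j)

/-- The group `K_0' = 1 × O(1,n-1)`, as a set of complex matrices. -/
def K0' (n : ℕ) : Set (Mat2 n ℂ) :=
  {k | ∃ C ∈ O1 n, k = Matrix.fromBlocks 1 0 0 (C.map Complex.ofReal)}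

/-- The annulus `ε < |z| < 1/ε`. -/
def annulus (ε : ℝ) : Set ℂ := {z | ε < ‖z‖ ∧ ‖z‖ < 1 / ε}

/-- The exterior `|z| > ε` of the disk of radius `ε`. -/
def exterior (ε : ℝ) : Set ℂ := {z | ε < ‖z‖}

/-- The loop group `L^{σ_0}`: holomorphic loops on the annulus with
`f(z̄)^* J̃ f(z) = J̃`, `conj (f(z̄)) = f(z)` and `σ_0(f(-z)) = f(z)`. -/
def LoopGroup (n : ℕ) (ε : ℝ) : Set (ℂ → Mat2 n ℂ) :=
  {f | (∀ p q, DifferentiableOn ℂ (fun z => f z p q) (annulus ε)) ∧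
    ∀ z ∈ annulus ε,
      IsUnit (f z).det ∧
      (f (starRingEnd ℂ z))ᴴ * Jt n ℂ * f z = Jt n ℂ ∧
      (f (starRingEnd ℂ z)).map (starRingEnd ℂ) = f z ∧
      sigma0 (f (-z)) = f z}

/-- The negative loop group `L^{σ_0}_-`: loops in `L^{σ_0}` that are holomorphic and
invertible outside the disk of radius `ε`, `∞` included, with `f(∞) ∈ K_0'`. -/
def LMinus (n : ℕ) (ε : ℝ) : Set (ℂ → Mat2 n ℂ) :=
  {f | f ∈ LoopGroup n ε ∧
    (∀ p q, DifferentiableOn ℂ (fun z => f z p q) (exterior ε)) ∧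
    (∀ z ∈ exterior ε, IsUnit (f z).det) ∧
    ∃ k ∈ K0' n, Filter.Tendsto f (Bornology.cobounded ℂ) (nhds k)}

/-- `c` is the sequence of Laurent coefficients of `ξ` on the annulus. -/
def HasLaurent {n : ℕ} (ε : ℝ) (ξ : ℂ → Mat2 n ℂ) (c : ℤ → Mat2 n ℂ) : Prop :=
  ∀ z ∈ annulus ε, HasSum (fun j : ℤ => z ^ j • c j) (ξ z)

/-- The value at `z` of `π̂_+(∑_{j ≤ N} c_j z^j)`. -/
def piPlus {n : ℕ} (N : ℕ) (c : ℤ → Mat2 n ℂ) (z : ℂ) : Mat2 n ℂ :=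
  piS0 (c 0)
    - piS1 (∑ j ∈ (Finset.Icc 1 N).filter (fun j => Even j), (c (j : ℤ) + sigma1 (c (j : ℤ))))
    + ∑ j ∈ Finset.Icc 1 N, (z ^ j • c (j : ℤ) + (z ^ j)⁻¹ • sigma1 (c (j : ℤ)))

/-- `η = π̂_+(ξ)` on the annulus, for a loop `ξ = ∑_{j ≤ N} c_j z^j`. -/
def IsPiPlus {n : ℕ} (ε : ℝ) (ξ η : ℂ → Mat2 n ℂ) : Prop :=
  ∃ (N : ℕ) (c : ℤ → Mat2 n ℂ), HasLaurent ε ξ c ∧ (∀ j : ℤ, (N : ℤ) < j → c j = 0) ∧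
    ∀ z ∈ annulus ε, η z = piPlus N c z

/-- `J_{a,1} = a z + σ_1(a) z⁻¹`. -/
def Jloop {n : ℕ} (a : Mat2 n ℂ) (z : ℂ) : Mat2 n ℂ := z • a + z⁻¹ • sigma1 a

/-- `a_i = (1/2) [[0, e_i], [e_i, 0]]`, with `e_i` the diagonal matrix unit. -/
def aDir {n : ℕ} (R : Type*) [Field R] (i : Fin n) : Mat2 n R :=
  (1 / 2 : R) • Matrix.fromBlocks 0 (Matrix.single i i 1) (Matrix.single i i 1) 0

/-- The 1-dimensional twisted `O(J,J)/(O(J) × O(J))`-system in the directions `a_i`, on `U`: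
with `θ_i = π̂_+(M J_{a_i,1} M⁻¹)` and `M(x, ·) ∈ L^{σ_0}_-`, the operators `∂_{x_i} + θ_i`
commute. -/
def OneDimTwistedSystem {n : ℕ} (ε : ℝ) (U : Set (Coord n)) (a : Fin n → Mat2 n ℂ)
    (M : Coord n → ℂ → Mat2 n ℂ) (θ : Fin n → Coord n → ℂ → Mat2 n ℂ) : Prop :=
  (∀ x ∈ U, M x ∈ LMinus n ε) ∧
  (∀ z ∈ exterior ε, SmoothMat U (fun x => M x z)) ∧
  (∀ i, ∀ x ∈ U, IsPiPlus ε (fun z => M x z * Jloop (a i) z * (M x z)⁻¹) (θ i x)) ∧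
  (∀ i j, ∀ x ∈ U, ∀ z ∈ annulus ε,
    pdMat i (fun y => θ j y z) x - pdMat j (fun y => θ i y z) x
      + (θ i x z * θ j x z - θ j x z * θ i x z) = 0)

/-- `g = b⁻¹ = diag(I_n, Aᵗ)`. -/
def gMat {n : ℕ} (A : Matrix (Fin n) (Fin n) ℝ) : Mat2 n ℝ := Matrix.fromBlocks 1 0 0 Aᵀ

/-- `b a_i b⁻¹ = g⁻¹ a_i g`. -/
def conjA {n : ℕ} (A : Matrix (Fin n) (Fin n) ℝ) (i : Fin n) : Mat2 n ℝ :=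
  (gMat A)⁻¹ * aDir ℝ i * gMat A

/-- `θ_i = b a_i b⁻¹ z + v_i + σ_1(b a_i b⁻¹) z⁻¹` with `v_i = diag(u_i, 0)`. -/
def thetaOf {n : ℕ} (A : Coord n → Matrix (Fin n) (Fin n) ℝ)
    (u : Fin n → Coord n → Matrix (Fin n) (Fin n) ℝ)
    (i : Fin n) (x : Coord n) (z : ℂ) : Mat2 n ℂ :=
  z • (conjA (A x) i).map Complex.ofReal
    + (Matrix.fromBlocks (u i x) 0 0 0 : Mat2 n ℝ).map Complex.ofReal
    + z⁻¹ • (sigma1 (conjA (A x) i)).map Complex.ofReal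

/-- `(A, u)` solves the 1-dimensional twisted system: `A` takes values in `O(1,n-1)`, the `u_i`
in `o(1,n-1)`, and `π̂_+(M J_{a_i,1} M⁻¹) = b a_i b⁻¹ z + v_i + σ_1(b a_i b⁻¹) z⁻¹`
for some `M` that solves the system. -/
def SolvesTwisted {n : ℕ} (ε : ℝ) (U : Set (Coord n))
    (A : Coord n → Matrix (Fin n) (Fin n) ℝ)
    (u : Fin n → Coord n → Matrix (Fin n) (Fin n) ℝ) : Prop :=
  SmoothMat U A ∧ (∀ i, SmoothMat U (u i)) ∧
  (∀ x ∈ U, A x ∈ O1 n) ∧ (∀ i, ∀ x ∈ U, u i x ∈ o1 n) ∧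
  ∃ M : Coord n → ℂ → Mat2 n ℂ,
    OneDimTwistedSystem ε U (fun i => aDir ℂ i) M (thetaOf A u)

/-! ## The generalized sinh-Gordon equation -/

/-- The generalized sinh-Gordon equation for `A = (a^k_i)` (row `k`, column `i`) and
`F = (f_ij)`. -/
structure GenSinhGordon {n : ℕ} [NeZero n] (U : Set (Coord n))
    (A F : Coord n → Matrix (Fin n) (Fin n) ℝ) : Prop where
  smoothA : SmoothMat U A
  smoothF : SmoothMat U F
  orth : ∀ x ∈ U, A x ∈ O1 n
  diag : ∀ x ∈ U, ∀ i, F x i i = 0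
  first : ∀ x ∈ U, ∀ i j k, i ≠ j → pd j (fun y => A y k i) x = A x k j * F x i j
  second : ∀ x ∈ U, ∀ i j, i ≠ j →
    eps ℝ j * pd j (fun y => F y i j) x + eps ℝ i * pd i (fun y => F y j i) x
      + ∑ k ∈ Finset.univ.filter (fun k => k ≠ i ∧ k ≠ j), eps ℝ k * F x i k * F x j k
      = -(A x 0 i * A x 0 j)
  third : ∀ x ∈ U, ∀ i j k, i ≠ j → j ≠ k → i ≠ k →
    pd k (fun y => F y i j) x = F x i k * F x k j

/-- The value on `∂_{x_k}` of the matrix of 1-forms `δ F - J Fᵗ δ J`, `δ = diag(dx_1, …, dx_n)`. -/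
def connOf {n : ℕ} (F : Matrix (Fin n) (Fin n) ℝ) (k : Fin n) : Matrix (Fin n) (Fin n) ℝ :=
  Matrix.single k k 1 * F - J n ℝ * Fᵀ * Matrix.single k k 1 * J n ℝ

/-! ## Structure, Gauss and Codazzi equations -/

/-- The indices `λ = 2, …, n` of the normal frame `e_{n+1}, …, e_{2n-1}`. -/
abbrev NIdx (n : ℕ) [NeZero n] : Type := {k : Fin n // k ≠ 0}

/-- The structure, Gauss, Codazzi and Ricci equations in an adapted orthonormal moving frame, for
a time-like `n`-dimensional submanifold of flat `ℝ^{2n-1}_1` and a parallel normal frame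
(the forms `ω^λ_μ` vanish). Here `θ^i` is the dual coframe, `W i j = ω^i_j` the tangential connection
forms, `τ^λ_i = ω^λ_i` the second fundamental forms, and `ω^i_λ = -ε_i ω^λ_i`. -/
structure StructureEquations {n : ℕ} [NeZero n] (U : Set (Coord n))
    (θ : Fin n → OneForm n) (W : Fin n → Fin n → OneForm n)
    (τ : NIdx n → Fin n → OneForm n) : Prop where
  torsion : ∀ x ∈ U, ∀ i k l, extD (θ i) x k l = ∑ j, wedge (θ j) (W i j) x k l
  metric : ∀ x ∈ U, ∀ i j k, eps ℝ i * W i j x k + eps ℝ j * W j i x k = 0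
  gauss : ∀ x ∈ U, ∀ i j k l,
    extD (W i j) x k l + ∑ m, wedge (W i m) (W m j) x k l
      + ∑ s, wedge (fun y p => -(eps ℝ i * τ s i y p)) (τ s j) x k l = 0
  codazzi : ∀ x ∈ U, ∀ s i k l,
    extD (τ s i) x k l + ∑ j, wedge (τ s j) (W j i) x k l = 0
  ricci : ∀ x ∈ U, ∀ s t k l,
    ∑ j, wedge (τ s j) (fun y p => -(eps ℝ j * τ t j y p)) x k l = 0

/-- `θ^i = a^1_i dx_i`, the coframe of `I = ∑ ε_i (a^1_i)² dx_i²`. -/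
def coframe {n : ℕ} [NeZero n] (A : Coord n → Matrix (Fin n) (Fin n) ℝ) (i : Fin n) : OneForm n :=
  fun x k => if k = i then A x 0 i else 0

/-- `ω^λ_i = ε_i a^λ_i dx_i`, that is `II^λ = ∑ ω^λ_i ⊗ θ^i = ∑ ε_i a^1_i a^λ_i dx_i²`. -/
def normalForm {n : ℕ} [NeZero n] (A : Coord n → Matrix (Fin n) (Fin n) ℝ)
    (s : NIdx n) (i : Fin n) : OneForm n :=
  fun x k => if k = i then eps ℝ i * A x s.1 i else 0

/-- The Gauss-Codazzi and structure equations of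
`I = ∑ ε_i (a^1_i)² dx_i²`, `II = ∑ ε_i a^1_i a^λ_i dx_i² e_{n+λ-1}`,
with connection matrix `ω = ∑ u_k dx_k` and parallel normal frame. -/
def GaussCodazzi {n : ℕ} [NeZero n] (U : Set (Coord n))
    (A : Coord n → Matrix (Fin n) (Fin n) ℝ)
    (u : Fin n → Coord n → Matrix (Fin n) (Fin n) ℝ) : Prop :=
  (∀ k, SmoothMat U (u k)) ∧
  StructureEquations U (coframe A) (fun i j x k => u k x i j) (normalForm A)

/-! ## Time-like submanifolds of constant curvature -/

/-- `ℝ^{2n-1}_1`. -/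
abbrev Ambient (n : ℕ) : Type := Fin (2 * n - 1) → ℝ

/-- The scalar product `-x_1 y_1 + x_2 y_2 + …` of `ℝ^{2n-1}_1`. -/
def mink {n : ℕ} (v w : Ambient n) : ℝ := ∑ i, eps ℝ i * v i * w i

/-- The induced metric `g_ij = ⟨∂_i X, ∂_j X⟩`. -/
def induced {n : ℕ} (X : Coord n → Ambient n) (x : Coord n) : Matrix (Fin n) (Fin n) ℝ :=
  Matrix.of fun i j => mink (pd i X x) (pd j X x)

/-- Christoffel symbols `Γ^k_ij` of a metric. -/
def christoffel {n : ℕ} (g : Coord n → Matrix (Fin n) (Fin n) ℝ)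
    (k i j : Fin n) (x : Coord n) : ℝ :=
  (1 / 2) * ∑ l, (g x)⁻¹ k l *
    (pd i (fun y => g y j l) x + pd j (fun y => g y i l) x - pd l (fun y => g y i j) x)

/-- The components `R^l_kij` of the curvature tensor: `R(∂_i, ∂_j) ∂_k = ∑ R^l_kij ∂_l`. -/
def riemann {n : ℕ} (g : Coord n → Matrix (Fin n) (Fin n) ℝ)
    (l k i j : Fin n) (x : Coord n) : ℝ :=
  pd i (christoffel g l j k) x - pd j (christoffel g l i k) x
    + ∑ m, (christoffel g l i m x * christoffel g m j k x
        - christoffel g l j m x * christoffel g m i k x)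

/-- Constant sectional curvature `1` on `U`: for `v`, `w` spanning a nondegenerate plane,
`⟨R(v,w)w, v⟩ = ⟨v,v⟩⟨w,w⟩ - ⟨v,w⟩²`. -/
def ConstCurvOne {n : ℕ} (U : Set (Coord n))
    (g : Coord n → Matrix (Fin n) (Fin n) ℝ) : Prop :=
  ∀ x ∈ U, ∀ v w : Fin n → ℝ,
    (v ⬝ᵥ (g x *ᵥ v)) * (w ⬝ᵥ (g x *ᵥ w)) - (v ⬝ᵥ (g x *ᵥ w)) ^ 2 ≠ 0 →
    ∑ p, ∑ l, ∑ k, ∑ i, ∑ j, g x l p * riemann g l k i j x * v i * w j * w k * v p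
      = (v ⬝ᵥ (g x *ᵥ v)) * (w ⬝ᵥ (g x *ᵥ w)) - (v ⬝ᵥ (g x *ᵥ w)) ^ 2

/-- `X : U → ℝ^{2n-1}_1` is a coordinate parametrization of a time-like submanifold of constant
sectional curvature `1`, and `e` an orthonormal parallel normal frame, such that
`I = ∑ ε_i (a^1_i)² dx_i²` and `II = ∑ ε_i a^1_i a^λ_i dx_i² e_{n+λ-1}`. -/
structure TimelikeSubmanifold {n : ℕ} [NeZero n] (U : Set (Coord n))
    (X : Coord n → Ambient n) (e : NIdx n → Coord n → Ambient n)
    (A : Coord n → Matrix (Fin n) (Fin n) ℝ) : Prop where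
  smoothX : ContDiffOn ℝ ∞ X U
  smoothe : ∀ s, ContDiffOn ℝ ∞ (e s) U
  timelike : ∀ x ∈ U, ∃ P : Matrix (Fin n) (Fin n) ℝ,
    IsUnit P.det ∧ Pᵀ * induced X x * P = J n ℝ
  curvature : ConstCurvOne U (induced X)
  orthonormal : ∀ x ∈ U, ∀ s t, mink (e s x) (e t x) = if s = t then 1 else 0
  normal : ∀ x ∈ U, ∀ s i, mink (e s x) (pd i X x) = 0
  parallel : ∀ x ∈ U, ∀ s t i, mink (pd i (e s) x) (e t x) = 0
  firstForm : ∀ x ∈ U, ∀ i j,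
    mink (pd i X x) (pd j X x) = if i = j then eps ℝ i * A x 0 i ^ 2 else 0
  secondForm : ∀ x ∈ U, ∀ (s : NIdx n) i j,
    mink (pd i (pd j X) x) (e s x) = if i = j then eps ℝ i * A x 0 i * A x s.1 i else 0

/-- The unit tangent frame `e_i = ∂_i X / a^1_i`. -/
def tangentFrame {n : ℕ} [NeZero n] (X : Coord n → Ambient n)
    (A : Coord n → Matrix (Fin n) (Fin n) ℝ) (i : Fin n) (x : Coord n) : Ambient n :=
  (A x 0 i)⁻¹ • pd i X x

/-- The Levi-Civita connection matrix of the submanifold in the frame `e_i`: the value on `∂_{x_k}`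
of `ω^i_j = ε_i ⟨de_j, e_i⟩`, the tangential part of `de_j`. -/
def tangentConn {n : ℕ} [NeZero n] (X : Coord n → Ambient n)
    (A : Coord n → Matrix (Fin n) (Fin n) ℝ) (k : Fin n) (x : Coord n) :
    Matrix (Fin n) (Fin n) ℝ :=
  Matrix.of fun i j => eps ℝ i * mink (pd k (tangentFrame X A j) x) (tangentFrame X A i x)

end SinhG

end

/-! All the systems are one zero curvature equation. For `A` in O(1,n-1) and u_i in o(1,n-1), the
curvature of ∂_i + θ_i has only two independent coefficients: `firstCoeff`, multiplied by the
diagonal matrix (z - z⁻¹J)/2, and the z-independent `zerothCoeff` (`curvature_thetaOf`). Their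
vanishing is `LaxSystem`, with which every other system is compared.

Gauss–Codazzi (`gaussCodazzi_iff_laxSystem`): the first row of `A` in `firstCoeff` gives torsion,
the other rows give Codazzi, and `zerothCoeff` gives Gauss, because J-orthogonality of the columns
turns ∑_{λ≥2} a^λ_i a^λ_j into a^1_i a^1_j for i ≠ j.

Sinh-Gordon (`LaxSystem.eq_connOf`, `LaxSystem.genSinhGordon`, `GenSinhGordon.laxSystem`):
`firstCoeff` confines u_k to row k and column k, so the u_k are encoded by one off-diagonal matrix
F; the remaining entries are the equations for F.

Twisted system: one real z > 1 recovers both coefficients from flatness. Conversely a loop M is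
needed, but no differential equation for it has to be solved: M = exp(z⁻¹P) b works with P algebraic
in `A` and F. Indeed π̂_+ sees only the coefficients of z and 1 in M J_{a_i,1} M⁻¹, which are b a_i
b⁻¹ and [P, b a_i b⁻¹], and P is chosen so that the upper left block of the commutator is u_i
(`isPiPlus_dressing`).

For a submanifold, the equations follow from symmetry of second derivatives of X and of the tangent
frame, expanded by Parseval's identity in the adapted frame
(`TimelikeSubmanifold.structureEquations`). -/

noncomputable section

namespace SinhG

/-! ## Calculus of partial derivatives -/

section Calculus

variable {n : ℕ} {F : Type*} [NormedAddCommGroup F] [NormedSpace ℝ F]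
  {U : Set (Coord n)} {x : Coord n}

theorem pd_congr (hU : IsOpen U) (hx : x ∈ U) {f g : Coord n → F} (h : ∀ y ∈ U, f y = g y)
    (i : Fin n) : pd i f x = pd i g x := by
  have : f =ᶠ[nhds x] g := Filter.eventuallyEq_of_mem (hU.mem_nhds hx) h
  simp [pd, this.fderiv_eq]

theorem pd_const (c : F) (i : Fin n) : pd i (fun _ => c) x = 0 := by
  simp [pd]

theorem pd_sub {f g : Coord n → F} (hf : DifferentiableAt ℝ f x) (hg : DifferentiableAt ℝ g x)
    (i : Fin n) : pd i (fun y => f y - g y) x = pd i f x - pd i g x := by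
  simp [pd, fderiv_fun_sub hf hg]

theorem pd_sum {ι : Type*} {s : Finset ι} {f : ι → Coord n → F}
    (hf : ∀ k ∈ s, DifferentiableAt ℝ (f k) x) (i : Fin n) :
    pd i (fun y => ∑ k ∈ s, f k y) x = ∑ k ∈ s, pd i (f k) x := by
  simp [pd, fderiv_fun_sum hf]

theorem pd_const_mul {f : Coord n → ℝ} (hf : DifferentiableAt ℝ f x) (c : ℝ) (i : Fin n) :
    pd i (fun y => c * f y) x = c * pd i f x := by
  simp [pd, fderiv_const_mul hf c]

theorem pd_clm {G : Type*} [NormedAddCommGroup G] [NormedSpace ℝ G] (L : F →L[ℝ] G)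
    {f : Coord n → F} (hf : DifferentiableAt ℝ f x) (i : Fin n) :
    pd i (fun y => L (f y)) x = L (pd i f x) := by
  have := (L.hasFDerivAt.comp x hf.hasFDerivAt).fderiv
  simp only [pd]
  exact congrArg (fun T : Coord n →L[ℝ] G => T (Pi.single i 1)) this

theorem differentiableAt_of_smooth (hU : IsOpen U) (hx : x ∈ U) {f : Coord n → F}
    (hf : ContDiffOn ℝ ∞ f U) : DifferentiableAt ℝ f x :=
  (hf.contDiffAt (hU.mem_nhds hx)).differentiableAt (by simp)

theorem SmoothMat.differentiableAt (hU : IsOpen U) (hx : x ∈ U) {ι : Type*}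
    {T : Coord n → Matrix ι ι F} (hT : SmoothMat U T) (p q : ι) :
    DifferentiableAt ℝ (fun y => T y p q) x :=
  differentiableAt_of_smooth hU hx (hT p q)

end Calculus

/-! ## Signs and the group `O(1,n-1)` -/

section Signs

variable {n : ℕ}

theorem eps_mul_self (R : Type*) [CommRing R] (i : Fin n) : eps R i * eps R i = 1 := by
  unfold eps; split_ifs <;> simp

theorem eps_ne_zero (i : Fin n) : eps ℝ i ≠ 0 := by
  unfold eps; split_ifs <;> simp

theorem J_mul_J (n : ℕ) (R : Type*) [CommRing R] : J n R * J n R = 1 := by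
  simp [J, eps_mul_self]

theorem J_transpose (n : ℕ) (R : Type*) [CommRing R] : (J n R)ᵀ = J n R := by
  simp [J]

theorem mem_o1_iff {u : Matrix (Fin n) (Fin n) ℝ} :
    u ∈ o1 n ↔ ∀ p q, eps ℝ p * u p q + eps ℝ q * u q p = 0 := by
  simp only [o1, Set.mem_ofPred_eq, ← Matrix.ext_iff]
  refine forall_congr' fun p => forall_congr' fun q => ?_
  simp [J, Matrix.mul_diagonal, Matrix.diagonal_mul]
  rw [mul_comm, add_comm]

theorem O1_columns {A : Matrix (Fin n) (Fin n) ℝ} (hA : A ∈ O1 n) (i j : Fin n) :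
    ∑ k, eps ℝ k * A k i * A k j = if i = j then eps ℝ i else 0 := by
  have h := congrFun (congrFun hA i) j
  rw [J, Matrix.mul_apply, Matrix.diagonal_apply] at h
  simp only [Matrix.mul_diagonal, Matrix.transpose_apply] at h
  rw [← h]
  exact Finset.sum_congr rfl fun k _ => by ring

/-- The Euclidean and Lorentzian pairings differ only in the first row, by the factor 1 - ε_1 = 2,
and the Lorentzian one vanishes. -/
theorem O1_euclidean_columns [NeZero n] {A : Matrix (Fin n) (Fin n) ℝ} (hA : A ∈ O1 n)
    {i j : Fin n} (hij : i ≠ j) : ∑ k, A k i * A k j = 2 * (A 0 i * A 0 j) := by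
  have h := O1_columns hA i j
  rw [if_neg hij] at h
  have h2 : ∑ k, A k i * A k j - ∑ k, eps ℝ k * A k i * A k j = 2 * (A 0 i * A 0 j) := by
    rw [← Finset.sum_sub_distrib, Finset.sum_eq_single 0]
    · simp [eps]; ring
    · intro b _ hb
      have : (b : ℕ) ≠ 0 := fun h => hb (Fin.ext (by simpa using h))
      simp [eps, this]
    · simp
  linarith

/-- Source of the right-hand side -a^1_i a^1_j: it evaluates the sum over the normal directions in
the Gauss equation. -/
theorem O1_normal_columns [NeZero n] {A : Matrix (Fin n) (Fin n) ℝ} (hA : A ∈ O1 n)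
    {i j : Fin n} (hij : i ≠ j) : ∑ s : NIdx n, A s.1 i * A s.1 j = A 0 i * A 0 j := by
  have h := O1_euclidean_columns hA hij
  rw [← Fintype.sum_subtype_add_sum_subtype (fun k : Fin n => k ≠ 0)] at h
  have h0 : ∑ k : {k : Fin n // ¬ k ≠ 0}, A k.1 i * A k.1 j = A 0 i * A 0 j := by
    rw [Fintype.sum_eq_single (⟨0, by simp⟩ : {k : Fin n // ¬ k ≠ 0})]
    exact fun a ha => absurd (Subtype.ext (not_not.mp a.2)) ha
  linarith

end Signs

/-! ## The coefficients of the zero curvature equation -/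

section Coordinates

variable {n : ℕ} {U : Set (Coord n)}

theorem extD_diagonal (f : Coord n → ℝ) (i : Fin n) (x : Coord n) (k l : Fin n) :
    extD (fun y q => if q = i then f y else 0) x k l
      = (if l = i then pd k f x else 0) - (if k = i then pd l f x else 0) := by
  unfold extD
  by_cases h1 : l = i <;> by_cases h2 : k = i <;> simp [h1, h2, pd_const]

/-- The coefficient of `z` in the curvature of `∂_i + θ_i`, as a condition on `A` and `u`. -/
def firstCoeff (A : Coord n → Matrix (Fin n) (Fin n) ℝ)
    (u : Fin n → Coord n → Matrix (Fin n) (Fin n) ℝ) (i j : Fin n) (x : Coord n) :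
    Matrix (Fin n) (Fin n) ℝ :=
  Matrix.of fun p r => (if p = j then pd i (fun y => A y r j) x else 0)
    - (if p = i then pd j (fun y => A y r i) x else 0)
    + (u i x p j * A x r j - u j x p i * A x r i)

theorem connOf_apply (F : Matrix (Fin n) (Fin n) ℝ) (k p q : Fin n) :
    connOf F k p q = (if p = k then F k q else 0)
      - (if q = k then eps ℝ p * eps ℝ k * F k p else 0) := by
  have h1 : (Matrix.single k k (1 : ℝ) * F) p q = if p = k then F k q else 0 := by
    by_cases h : p = k <;> simp [Matrix.mul_apply, Matrix.single_apply, h, eq_comm (a := k)]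
  have h2 : (J n ℝ * Fᵀ * Matrix.single k k 1 * J n ℝ : Matrix (Fin n) (Fin n) ℝ) p q
      = if q = k then eps ℝ p * eps ℝ k * F k p else 0 := by
    rw [Matrix.mul_assoc (J n ℝ)]
    simp only [J, Matrix.mul_diagonal, Matrix.diagonal_mul]
    by_cases h : q = k
    · simp [Matrix.mul_apply, Matrix.single_apply, h]; ring
    · simp [Matrix.mul_apply, h, eq_comm (a := k)]
  simp [connOf, h1, h2]

theorem connOf_mem_o1 (F : Matrix (Fin n) (Fin n) ℝ) (k : Fin n) : connOf F k ∈ o1 n := by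
  rw [mem_o1_iff]
  intro p q
  rw [connOf_apply, connOf_apply]
  have hp := eps_mul_self ℝ p
  have hq := eps_mul_self ℝ q
  by_cases h1 : p = k <;> by_cases h2 : q = k <;> simp only [h1, h2, if_true, if_false]
  · subst h1; linear_combination (-2 * F p p * eps ℝ p) * hp
  · linear_combination -(F k q) * (eps ℝ k) * hq
  · linear_combination -(F k p) * (eps ℝ k) * hp
  · simp

theorem smooth_connOf {F : Coord n → Matrix (Fin n) (Fin n) ℝ} (hF : SmoothMat U F) (k : Fin n) :
    SmoothMat U (fun x => connOf (F x) k) := by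
  intro p q
  simp only [connOf_apply]
  refine ContDiffOn.sub ?_ ?_
  · split_ifs
    · exact hF _ _
    · exact contDiffOn_const
  · split_ifs
    · exact contDiffOn_const.mul (hF _ _)
    · exact contDiffOn_const

theorem pd_connOf (hU : IsOpen U) {F : Coord n → Matrix (Fin n) (Fin n) ℝ} (hF : SmoothMat U F)
    {x : Coord n} (hx : x ∈ U) (i k p q : Fin n) :
    pd i (fun y => connOf (F y) k p q) x = (if p = k then pd i (fun y => F y k q) x else 0)
      - (if q = k then eps ℝ p * eps ℝ k * pd i (fun y => F y k p) x else 0) := by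
  have hd := fun p q => hF.differentiableAt hU hx p q
  simp only [connOf_apply]
  by_cases h1 : p = k <;> by_cases h2 : q = k <;> simp only [h1, h2, if_true, if_false]
  · rw [pd_sub (hd _ _) ((hd _ _).const_mul _), pd_const_mul (hd _ _)]
  · rw [pd_sub (hd _ _) (differentiableAt_const _), pd_const]
  · rw [pd_sub (differentiableAt_const _) ((hd _ _).const_mul _), pd_const_mul (hd _ _), pd_const]
  · rw [pd_sub (differentiableAt_const _) (differentiableAt_const _), pd_const]

/-- The left factor lives on p = i or m = i, the right one on m = j or q = j. Of the four
combinations, m = i with m = j is impossible, two fix m, and p = i with q = j leaves the full sum.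
-/
theorem connOf_mul_connOf (F : Matrix (Fin n) (Fin n) ℝ) {i j : Fin n} (hij : i ≠ j) (p q : Fin n) :
    ∑ m, connOf F i p m * connOf F j m q = (if p = i then F i j * F j q else 0)
      - (if p = i ∧ q = j then eps ℝ j * ∑ m, eps ℝ m * F i m * F j m else 0)
      + (if q = j then eps ℝ p * eps ℝ j * (F i p * F j i) else 0) := by
  have hi := eps_mul_self ℝ i
  have e : ∀ m, connOf F i p m * connOf F j m q
      = (if m = j then (if p = i then F i j * F j q else 0) else 0)
        - (if p = i ∧ q = j then eps ℝ j * (eps ℝ m * F i m * F j m) else 0)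
        + (if m = i then (if q = j then eps ℝ p * eps ℝ j * (F i p * F j i) else 0) else 0) := by
    intro m
    rw [connOf_apply, connOf_apply]
    by_cases hmj : m = j
    · have hmi : ¬ m = i := fun h => hij (h ▸ hmj)
      subst hmj
      by_cases h1 : p = i <;> by_cases h2 : q = m <;> simp [hmi, h1, h2] <;> ring
    · by_cases hmi : m = i
      · subst hmi
        by_cases h1 : p = m <;> by_cases h2 : q = j <;> simp [hmj, h1, h2]
        · linear_combination (exp := 1) (F m m * F j m * eps ℝ m * eps ℝ j) * hi
        · linear_combination (exp := 1) (F m p * F j m * eps ℝ p * eps ℝ j) * hi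
      · by_cases h1 : p = i <;> by_cases h2 : q = j <;> simp [hmi, hmj, h1, h2] <;> ring
  simp only [e, Finset.sum_add_distrib, Finset.sum_sub_distrib, Finset.sum_ite_eq', Finset.mem_univ,
    if_true]
  congr 2
  split_ifs <;> simp [Finset.mul_sum]

theorem sum_off_diagonal {F : Matrix (Fin n) (Fin n) ℝ} (hF : ∀ i, F i i = 0) (i j : Fin n) :
    ∑ k ∈ Finset.univ.filter (fun k => k ≠ i ∧ k ≠ j), eps ℝ k * F i k * F j k
      = ∑ m, eps ℝ m * F i m * F j m := by
  rw [Finset.sum_filter]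
  refine Finset.sum_congr rfl fun m _ => ?_
  by_cases h1 : m = i
  · subst h1; simp [hF]
  · by_cases h2 : m = j
    · subst h2; simp [hF]
    · simp [h1, h2]

end Coordinates

/-! ### The coefficientwise zero curvature system and its equivalent forms. -/

section LaxSystem

variable {n : ℕ} [NeZero n] {U : Set (Coord n)} {A : Coord n → Matrix (Fin n) (Fin n) ℝ}
  {u : Fin n → Coord n → Matrix (Fin n) (Fin n) ℝ}

/-- The constant coefficient in the curvature of `∂_i + θ_i`. -/
def zerothCoeff (A : Coord n → Matrix (Fin n) (Fin n) ℝ)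
    (u : Fin n → Coord n → Matrix (Fin n) (Fin n) ℝ) (i j : Fin n) (x : Coord n) :
    Matrix (Fin n) (Fin n) ℝ :=
  Matrix.of fun p q => pd i (fun y => u j y p q) x - pd j (fun y => u i y p q) x
    + (∑ m, u i x p m * u j x m q - ∑ m, u j x p m * u i x m q)
    - ((if p = i ∧ q = j then eps ℝ j * (A x 0 i * A x 0 j) else 0)
      - (if p = j ∧ q = i then eps ℝ i * (A x 0 i * A x 0 j) else 0))

/-- The zero curvature equation, coefficient by coefficient. -/
structure LaxSystem (U : Set (Coord n)) (A : Coord n → Matrix (Fin n) (Fin n) ℝ)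
    (u : Fin n → Coord n → Matrix (Fin n) (Fin n) ℝ) : Prop where
  smooth : ∀ i, SmoothMat U (u i)
  skew : ∀ i, ∀ x ∈ U, u i x ∈ o1 n
  first : ∀ x ∈ U, ∀ i j, firstCoeff A u i j x = 0
  zeroth : ∀ x ∈ U, ∀ i j, zerothCoeff A u i j x = 0

/-! ### The Gauss-Codazzi equations -/

theorem torsion_iff {x : Coord n} {i k l : Fin n} :
    extD (coframe A i) x k l = ∑ j, wedge (coframe A j) (fun x k => u k x i j) x k l ↔
      firstCoeff A u k l x i 0 = 0 := by
  have h : extD (coframe A i) x k l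
      = (if l = i then pd k (fun y => A y 0 i) x else 0)
        - (if k = i then pd l (fun y => A y 0 i) x else 0) := extD_diagonal _ i x k l
  rw [h]
  simp only [wedge, coframe, ite_mul, zero_mul, Finset.sum_sub_distrib, Finset.sum_ite_eq,
    Finset.mem_univ, if_true, firstCoeff, Matrix.of_apply]
  rw [← sub_eq_zero]
  refine Eq.congr ?_ rfl
  by_cases h1 : l = i <;> by_cases h2 : k = i <;>
    simp [h1, h2, eq_comm (a := i)] <;> ring

/-- Skewness of u moves the free index i into the row position of u; what remains is the entry of
`firstCoeff` times the unit ε_i. -/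
theorem codazzi_iff (hU : IsOpen U) (hA : SmoothMat U A) {x : Coord n} (hx : x ∈ U)
    (hskew : ∀ i, u i x ∈ o1 n) {s : NIdx n} {i k l : Fin n} :
    extD (normalForm A s i) x k l + ∑ j, wedge (normalForm A s j) (fun x k => u k x j i) x k l = 0 ↔
      firstCoeff A u k l x i s.1 = 0 := by
  have h : extD (normalForm A s i) x k l
      = (if l = i then pd k (fun y => eps ℝ i * A y s.1 i) x else 0)
        - (if k = i then pd l (fun y => eps ℝ i * A y s.1 i) x else 0) := extD_diagonal _ i x k l
  rw [h]
  simp only [wedge, normalForm, ite_mul, zero_mul, Finset.sum_sub_distrib, Finset.sum_ite_eq,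
    Finset.mem_univ, if_true, firstCoeff, Matrix.of_apply,
    pd_const_mul (hA.differentiableAt hU hx _ _)]
  have h1 := mem_o1_iff.1 (hskew l) k i
  have h2 := mem_o1_iff.1 (hskew k) l i
  have key : (if l = i then eps ℝ i * pd k (fun y => A y s.1 i) x else 0)
        - (if k = i then eps ℝ i * pd l (fun y => A y s.1 i) x else 0)
        + (eps ℝ k * A x s.1 k * u l x k i - eps ℝ l * A x s.1 l * u k x l i)
      = eps ℝ i * ((if i = l then pd k (fun y => A y s.1 l) x else 0)
        - (if i = k then pd l (fun y => A y s.1 k) x else 0)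
        + (u k x i l * A x s.1 l - u l x i k * A x s.1 k)) := by
    have e1 : eps ℝ k * A x s.1 k * u l x k i = - (eps ℝ i * u l x i k * A x s.1 k) := by
      linear_combination A x s.1 k * h1
    have e2 : eps ℝ l * A x s.1 l * u k x l i = - (eps ℝ i * u k x i l * A x s.1 l) := by
      linear_combination A x s.1 l * h2
    rw [e1, e2]
    by_cases h1 : l = i <;> by_cases h2 : k = i <;>
      simp [h1, h2, eq_comm (a := i)] <;> ring
  rw [key, mul_eq_zero, or_iff_right (eps_ne_zero i)]

/-- Both second fundamental forms are diagonal in the dx_i, so the normal term lives only on the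
(i,j) coordinate plane, where `O1_normal_columns` evaluates it. -/
theorem gauss_iff {x : Coord n} (hO : A x ∈ O1 n) {i j k l : Fin n} :
    extD (fun x k => u k x i j) x k l
      + ∑ m, wedge (fun x k => u k x i m) (fun x k => u k x m j) x k l
      + ∑ s : NIdx n, wedge (fun y p => -(eps ℝ i * normalForm A s i y p)) (normalForm A s j) x k l
        = 0 ↔ zerothCoeff A u k l x i j = 0 := by
  refine Eq.congr ?_ rfl
  have hs : ∑ s : NIdx n,
      wedge (fun y p => -(eps ℝ i * normalForm A s i y p)) (normalForm A s j) x k l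
      = -(((if k = i ∧ l = j then 1 else 0) - (if l = i ∧ k = j then 1 else 0))
        * (eps ℝ j * ∑ s : NIdx n, A x s.1 i * A x s.1 j)) := by
    rw [Finset.mul_sum, Finset.mul_sum, ← Finset.sum_neg_distrib]
    refine Finset.sum_congr rfl fun s _ => ?_
    have hi := eps_mul_self ℝ i
    have hand : ∀ a b c d : Fin n, (if a = b ∧ c = d then (1 : ℝ) else 0)
        = (if a = b then 1 else 0) * (if c = d then 1 else 0) := fun a b c d => by
      by_cases h1 : a = b <;> by_cases h2 : c = d <;> simp [h1, h2]
    have hone : ∀ (a b : Fin n) (c : ℝ), (if a = b then c else 0)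
        = (if a = b then 1 else 0) * c := fun a b c => by simp
    simp only [wedge, normalForm, hand]
    rw [hone k i (_ * _), hone l j (_ * _), hone l i (_ * _), hone k j (_ * _)]
    -- With the four indicators as free variables the identity is polynomial modulo ε_i² = 1.
    generalize (if k = i then (1 : ℝ) else 0) = a
    generalize (if l = j then (1 : ℝ) else 0) = b
    generalize (if l = i then (1 : ℝ) else 0) = c
    generalize (if k = j then (1 : ℝ) else 0) = d
    linear_combination (c * d - a * b) * eps ℝ j * A x s.1 i * A x s.1 j * hi
  rw [hs]
  simp only [extD, wedge, zerothCoeff, Matrix.of_apply, Finset.sum_sub_distrib]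
  by_cases hij : i = j
  · subst hij
    by_cases h1 : k = i <;> by_cases h2 : l = i <;> simp [h1, h2, eq_comm (a := i)]
  · rw [O1_normal_columns hO hij]
    have c1 : (if i = k ∧ j = l then eps ℝ l * (A x 0 k * A x 0 l) else 0)
        = (if k = i ∧ l = j then 1 else 0) * (eps ℝ j * (A x 0 i * A x 0 j)) := by
      by_cases h : k = i ∧ l = j
      · obtain ⟨rfl, rfl⟩ := h; simp
      · have h' : ¬ (i = k ∧ j = l) := fun h' => h ⟨h'.1.symm, h'.2.symm⟩
        simp [h, h']
    have c2 : (if i = l ∧ j = k then eps ℝ k * (A x 0 k * A x 0 l) else 0)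
        = (if l = i ∧ k = j then 1 else 0) * (eps ℝ j * (A x 0 i * A x 0 j)) := by
      by_cases h : l = i ∧ k = j
      · obtain ⟨rfl, rfl⟩ := h; simp [mul_comm]
      · have h' : ¬ (i = l ∧ j = k) := fun h' => h ⟨h'.1.symm, h'.2.symm⟩
        simp [h, h']
    rw [c1, c2]
    ring

theorem gaussCodazzi_iff_laxSystem (hU : IsOpen U) (hA : SmoothMat U A) (hO : ∀ x ∈ U, A x ∈ O1 n) :
    GaussCodazzi U A u ↔ LaxSystem U A u := by
  constructor
  · rintro ⟨hu, h⟩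
    have hskew : ∀ i, ∀ x ∈ U, u i x ∈ o1 n := fun i x hx =>
      mem_o1_iff.2 fun p q => h.metric x hx p q i
    refine ⟨hu, hskew, fun x hx k l => ?_, fun x hx k l => ?_⟩
    · ext i r
      by_cases hr : r = 0
      · subst hr; exact torsion_iff.1 (h.torsion x hx i k l)
      · exact (codazzi_iff hU hA hx (fun i => hskew i x hx)).1 (h.codazzi x hx ⟨r, hr⟩ i k l)
    · ext i j
      exact (gauss_iff (hO x hx)).1 (h.gauss x hx i j k l)
  · rintro ⟨hu, hskew, h1, h0⟩
    refine ⟨hu, fun x hx i k l => torsion_iff.2 (by rw [h1 x hx]; rfl),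
      fun x hx i j k => mem_o1_iff.1 (hskew k x hx) i j,
      fun x hx i j k l => (gauss_iff (hO x hx)).2 (by rw [h0 x hx]; rfl),
      fun x hx s i k l => (codazzi_iff hU hA hx (fun i => hskew i x hx)).2 (by rw [h1 x hx]; rfl),
      fun x hx s t k l => ?_⟩
    -- Ricci is automatic: for each j both normal forms are multiples of the same dx_j.
    refine Finset.sum_eq_zero fun j _ => ?_
    simp only [wedge, normalForm]
    split_ifs <;> simp

/-! ### The generalized sinh-Gordon equation -/

theorem zerothCoeff_connOf (hU : IsOpen U) {F : Coord n → Matrix (Fin n) (Fin n) ℝ}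
    (hF : SmoothMat U F) {x : Coord n} (hx : x ∈ U) {i j : Fin n} (hij : i ≠ j) (p q : Fin n) :
    zerothCoeff A (fun k x => connOf (F x) k) i j x p q =
      ((if p = j then pd i (fun y => F y j q) x else 0)
        - (if q = j then eps ℝ p * eps ℝ j * pd i (fun y => F y j p) x else 0))
      - ((if p = i then pd j (fun y => F y i q) x else 0)
        - (if q = i then eps ℝ p * eps ℝ i * pd j (fun y => F y i p) x else 0))
      + (((if p = i then F x i j * F x j q else 0)
          - (if p = i ∧ q = j then eps ℝ j * ∑ m, eps ℝ m * F x i m * F x j m else 0)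
          + (if q = j then eps ℝ p * eps ℝ j * (F x i p * F x j i) else 0))
        - ((if p = j then F x j i * F x i q else 0)
          - (if p = j ∧ q = i then eps ℝ i * ∑ m, eps ℝ m * F x j m * F x i m else 0)
          + (if q = i then eps ℝ p * eps ℝ i * (F x j p * F x i j) else 0)))
      - ((if p = i ∧ q = j then eps ℝ j * (A x 0 i * A x 0 j) else 0)
        - (if p = j ∧ q = i then eps ℝ i * (A x 0 i * A x 0 j) else 0)) := by
  simp only [zerothCoeff, Matrix.of_apply]
  rw [pd_connOf hU hF hx, pd_connOf hU hF hx, connOf_mul_connOf _ hij, connOf_mul_connOf _ hij.symm]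

theorem zerothCoeff_congr (hU : IsOpen U) {v : Fin n → Coord n → Matrix (Fin n) (Fin n) ℝ}
    (h : ∀ k, ∀ x ∈ U, u k x = v k x) {x : Coord n} (hx : x ∈ U) (i j : Fin n) :
    zerothCoeff A u i j x = zerothCoeff A v i j x := by
  ext p q
  simp only [zerothCoeff, Matrix.of_apply]
  rw [pd_congr hU hx (fun y hy => by rw [h j y hy]) i, pd_congr hU hx (fun y hy => by rw [h i y hy]) j,
    h i x hx, h j x hx]

/-- Off row and column i and j the curvature is zero. Entries (i,j) and (j,i) are the second-order
equation up to a sign unit, the other off-diagonal entries are ∂_k f_ij = f_ik f_kj, and (i,i) and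
(j,j) cancel. -/
theorem GenSinhGordon.laxSystem (hU : IsOpen U) {F : Coord n → Matrix (Fin n) (Fin n) ℝ}
    (h : GenSinhGordon U A F) (hu : ∀ k, ∀ x ∈ U, u k x = connOf (F x) k) : LaxSystem U A u := by
  refine ⟨fun i p q => (smooth_connOf h.smoothF i p q).congr fun x hx => by rw [hu i x hx],
    fun i x hx => hu i x hx ▸ connOf_mem_o1 _ _, fun x hx i j => ?_, fun x hx i j => ?_⟩
  · ext p r
    simp only [firstCoeff, Matrix.of_apply, hu _ x hx, connOf_apply, Matrix.zero_apply]
    have h0 := h.diag x hx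
    by_cases hij : i = j
    · subst hij; ring
    · have f1 := h.first x hx j i r (Ne.symm hij)
      have f2 := h.first x hx i j r hij
      by_cases h1 : p = i
      · subst h1
        simp [hij, Ne.symm hij, f2]; ring
      · by_cases h2 : p = j
        · subst h2
          simp [hij, Ne.symm hij, f1]; ring
        · simp [h1, h2, hij, Ne.symm hij]
  · by_cases hij : i = j
    · subst hij
      ext p q
      simp [zerothCoeff]
    rw [zerothCoeff_congr hU hu hx]
    ext p q
    rw [zerothCoeff_connOf hU h.smoothF hx hij, Matrix.zero_apply]
    have h0 := h.diag x hx
    have s1 := h.second x hx i j hij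
    rw [sum_off_diagonal h0] at s1
    have hG : ∑ m, eps ℝ m * F x j m * F x i m = ∑ m, eps ℝ m * F x i m * F x j m :=
      Finset.sum_congr rfl fun m _ => by ring
    rw [hG]
    have ei := eps_mul_self ℝ i
    have ej := eps_mul_self ℝ j
    have hd : ∀ k l, pd k (fun y => F y l l) x = 0 := fun k l => by
      rw [pd_congr hU hx (fun y hy => h.diag y hy l), pd_const]
    have hji := Ne.symm hij
    by_cases p1 : p = i
    · subst p1
      by_cases q1 : q = p
      · subst q1; simp [hij, hd, ei]; ring
      by_cases q2 : q = j
      · subst q2; simp [hij, hji, h0]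
        linear_combination -(eps ℝ q) * s1 + pd q (fun y => F y p q) x * ej
      · have t := h.third x hx p q j (Ne.symm q1) q2 hij
        simp [hij, q1, q2, t]
    by_cases p2 : p = j
    · subst p2
      by_cases q1 : q = i
      · subst q1; simp [hij, hji, h0]
        linear_combination (eps ℝ q) * s1 - pd q (fun y => F y p q) x * ei
      by_cases q2 : q = p
      · subst q2; simp [hji, hd, ej]; ring
      · have t := h.third x hx p q i (Ne.symm q2) q1 hji
        simp [hji, q1, q2, t]
    by_cases q1 : q = i
    · subst q1
      have t := h.third x hx q p j (Ne.symm p1) p2 hij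
      simp [hij, p1, p2, t]; ring
    by_cases q2 : q = j
    · subst q2
      have t := h.third x hx q p i (Ne.symm p2) p1 hji
      simp [hji, p1, p2, t]; ring
    simp [p1, p2, q1, q2]

/-- The matrix `F` read off from the connection matrices. -/
def offDiag (u : Fin n → Coord n → Matrix (Fin n) (Fin n) ℝ) (x : Coord n) :
    Matrix (Fin n) (Fin n) ℝ :=
  Matrix.of fun i j => if i = j then 0 else u i x i j

/-- Row k defines F, and skewness then determines column k and kills the diagonal. Every other entry
vanishes because distinct columns of `A` are J-orthogonal. -/
theorem LaxSystem.eq_connOf (hO : ∀ x ∈ U, A x ∈ O1 n) (h : LaxSystem U A u) (k : Fin n)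
    {x : Coord n} (hx : x ∈ U) : u k x = connOf (offDiag u x) k := by
  have hsk := fun k => mem_o1_iff.1 (h.skew k x hx)
  have h0 : ∀ k p, u k x p p = 0 := fun k p => by
    have := hsk k p p
    have h2 : eps ℝ p * u k x p p = 0 := by linarith
    exact (mul_eq_zero.1 h2).resolve_left (eps_ne_zero p)
  ext p q
  rw [connOf_apply]
  simp only [offDiag, Matrix.of_apply]
  have ep := eps_mul_self ℝ p
  by_cases h1 : p = k
  · subst h1
    by_cases h2 : q = p
    · subst h2; simp [h0]
    · simp [h2, Ne.symm h2]
  · by_cases h2 : q = k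
    · subst h2
      simp [h1, Ne.symm h1]
      have := hsk q p q
      linear_combination (eps ℝ p) * this - u q x p q * ep
    · by_cases h3 : p = q
      · subst h3; simp [h1, h0]
      · simp only [h1, h2, if_false, sub_zero]
        have hf : ∀ r, u k x p q * A x r q = u q x p k * A x r k := fun r => by
          have := congrFun (congrFun (h.first x hx k q) p) r
          simp [firstCoeff, h1, h3] at this
          linarith
        -- Contracting the proportionality of columns q and k with ε_r a^r_q annihilates the right
        -- side and leaves ε_q times the entry.
        have hs : u k x p q * ∑ r, eps ℝ r * A x r q * A x r q
            = u q x p k * ∑ r, eps ℝ r * A x r k * A x r q := by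
          rw [Finset.mul_sum, Finset.mul_sum]
          refine Finset.sum_congr rfl fun r _ => ?_
          linear_combination eps ℝ r * A x r q * hf r
        rw [O1_columns (hO x hx), O1_columns (hO x hx), if_neg (Ne.symm h2)] at hs
        simpa [eps_ne_zero] using hs

theorem LaxSystem.genSinhGordon (hU : IsOpen U) (hA : SmoothMat U A) (hO : ∀ x ∈ U, A x ∈ O1 n)
    (h : LaxSystem U A u) : GenSinhGordon U A (offDiag u) := by
  have hF : SmoothMat U (offDiag u) := fun p q => by
    by_cases hpq : p = q
    · simpa [offDiag, hpq] using contDiffOn_const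
    · simpa [offDiag, hpq] using h.smooth p p q
  have hd : ∀ x i, offDiag u x i i = 0 := fun x i => by simp [offDiag]
  have hu : ∀ k, ∀ x ∈ U, u k x = connOf (offDiag u x) k := fun k x hx => h.eq_connOf hO k hx
  have hz : ∀ x ∈ U, ∀ i j, zerothCoeff A (fun k x => connOf (offDiag u x) k) i j x = 0 :=
    fun x hx i j => by rw [← zerothCoeff_congr hU hu hx, h.zeroth x hx]
  refine ⟨hA, hF, hO, fun x _ => hd x, fun x hx i j k hij => ?_, fun x hx i j hij => ?_,
    fun x hx i j k hij hjk hik => ?_⟩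
  · have := congrFun (congrFun (h.first x hx j i) i) k
    simp only [firstCoeff, Matrix.of_apply, hu _ x hx, connOf_apply, Matrix.zero_apply, hd] at this
    simp [hij] at this
    linarith
  -- Entry (i,j) in directions i, j; multiplying by -ε_j restores the signs of the second-order
  -- equation.
  · have := congrFun (congrFun (hz x hx i j) i) j
    rw [zerothCoeff_connOf hU hF hx hij] at this
    simp [hij, Ne.symm hij, hd] at this
    rw [sum_off_diagonal (hd x)]
    have ej := eps_mul_self ℝ j
    linear_combination -(eps ℝ j) * this - (eps ℝ i * pd i (fun y => offDiag u y j i) x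
      + ∑ m, eps ℝ m * offDiag u x i m * offDiag u x j m + A x 0 i * A x 0 j) * ej
  -- In directions i, k the entry (i,j) with j ≠ i, k contains a single derivative, ∂_k f_ij.
  · have := congrFun (congrFun (hz x hx i k) i) j
    rw [zerothCoeff_connOf hU hF hx hik] at this
    simp [hik, hjk, Ne.symm hij] at this
    linarith

end LaxSystem

/-! ## The curvature of the twisted connection -/

section MatrixCalculus

variable {n : ℕ} {ι F : Type*} [NormedAddCommGroup F] [NormedSpace ℝ F]
  {U : Set (Coord n)} {x : Coord n}

theorem pdMat_congr (hU : IsOpen U) (hx : x ∈ U) {S T : Coord n → Matrix ι ι F}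
    (h : ∀ y ∈ U, S y = T y) (i : Fin n) : pdMat i S x = pdMat i T x := by
  ext p q
  exact pd_congr hU hx (fun y hy => by rw [h y hy]) i

theorem pdMat_ofReal {T : Coord n → Matrix ι ι ℝ}
    (hT : ∀ p q, DifferentiableAt ℝ (fun y => T y p q) x) (i : Fin n) :
    pdMat i (fun y => (T y).map Complex.ofReal) x = (pdMat i T x).map Complex.ofReal := by
  ext p q
  exact pd_clm Complex.ofRealCLM (hT p q) i

theorem pdMat_mul_mul [Fintype ι] {𝔸 : Type*} [NormedCommRing 𝔸] [NormedAlgebra ℝ 𝔸]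
    (P Q : Matrix ι ι 𝔸) {T : Coord n → Matrix ι ι 𝔸}
    (hT : ∀ p q, DifferentiableAt ℝ (fun y => T y p q) x) (i : Fin n) :
    pdMat i (fun y => P * T y * Q) x = P * pdMat i T x * Q := by
  ext p q
  simp only [pdMat, Matrix.of_apply, Matrix.mul_apply]
  have h1 : ∀ l, DifferentiableAt ℝ (fun y => ∑ k, P p k * T y k l) x := fun l =>
    DifferentiableAt.fun_sum fun k _ => (hT k l).const_mul _
  rw [pd_sum fun l _ => (h1 l).mul_const _]
  refine Finset.sum_congr rfl fun l _ => ?_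
  have h2 : pd i (fun y => (∑ k, P p k * T y k l) * Q l q) x
      = pd i (fun y => ∑ k, P p k * T y k l) x * Q l q := by
    simp only [pd]
    rw [fderiv_mul_const (h1 l)]
    simp [mul_comm]
  rw [h2, pd_sum fun k _ => (hT k l).const_mul _]
  congr 1
  refine Finset.sum_congr rfl fun k _ => ?_
  simp only [pd]
  rw [fderiv_const_mul (hT k l)]
  simp

theorem pdMat_fromBlocks {a b c d : Coord n → Matrix ι ι F} (i : Fin n) :
    pdMat i (fun y => Matrix.fromBlocks (a y) (b y) (c y) (d y)) x
      = Matrix.fromBlocks (pdMat i a x) (pdMat i b x) (pdMat i c x) (pdMat i d x) := by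
  ext (p | p) (q | q) <;> rfl

theorem fromBlocks_sub {R : Type*} [AddGroup R] (a b c d a' b' c' d' : Matrix ι ι R) :
    Matrix.fromBlocks a b c d - Matrix.fromBlocks a' b' c' d'
      = Matrix.fromBlocks (a - a') (b - b') (c - c') (d - d') := by
  ext (p | p) (q | q) <;> rfl

theorem pdMat_zero (i : Fin n) : pdMat i (fun _ => (0 : Matrix ι ι F)) x = 0 := by
  ext p q
  exact pd_const 0 i

end MatrixCalculus

/-! ### Block form of the twisted connection. -/

section Blocks

variable {n : ℕ} {A : Matrix (Fin n) (Fin n) ℝ}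

theorem J_map (n : ℕ) : (J n ℝ).map Complex.ofReal = J n ℂ := by
  ext i j
  simp only [J, Matrix.map_apply, Matrix.diagonal_apply, eps]
  split_ifs <;> simp

theorem map_mul_ofReal {ι : Type*} [Fintype ι] (P Q : Matrix ι ι ℝ) :
    (P * Q).map Complex.ofReal = P.map Complex.ofReal * Q.map Complex.ofReal :=
  Matrix.map_mul (f := Complex.ofRealHom)

theorem map_one_ofReal {ι : Type*} [DecidableEq ι] :
    (1 : Matrix ι ι ℝ).map Complex.ofReal = 1 :=
  Matrix.map_one _ Complex.ofReal_zero Complex.ofReal_one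

theorem map_zero_ofReal {ι : Type*} : (0 : Matrix ι ι ℝ).map Complex.ofReal = 0 :=
  Matrix.map_zero _ Complex.ofReal_zero

theorem map_single_ofReal (i : Fin n) :
    (Matrix.single i i (1 : ℝ)).map Complex.ofReal = Matrix.single i i 1 := by
  ext p q
  simp only [Matrix.map_apply, Matrix.single_apply]
  split_ifs <;> simp

/-- Identifies J A J as the inverse of `Aᵀ`, hence as the lower right block of b. -/
theorem O1_transpose_mul (hA : A ∈ O1 n) : Aᵀ * (J n ℝ * A * J n ℝ) = 1 := by
  have h : Aᵀ * J n ℝ * A = J n ℝ := hA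
  rw [← Matrix.mul_assoc, ← Matrix.mul_assoc, h, J_mul_J]

theorem O1_mul_transpose (hA : A ∈ O1 n) : J n ℝ * A * J n ℝ * Aᵀ = 1 :=
  mul_eq_one_comm.1 (O1_transpose_mul hA)

theorem O1_inverse_transpose_mem (hA : A ∈ O1 n) : J n ℝ * A * J n ℝ ∈ O1 n := by
  have h : Aᵀ * J n ℝ * A = J n ℝ := hA
  change (J n ℝ * A * J n ℝ)ᵀ * J n ℝ * (J n ℝ * A * J n ℝ) = J n ℝ
  simp only [Matrix.transpose_mul, J_transpose]
  have : J n ℝ * (Aᵀ * J n ℝ) * J n ℝ * (J n ℝ * A * J n ℝ)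
      = J n ℝ * Aᵀ * J n ℝ * (J n ℝ * J n ℝ) * A * J n ℝ := by noncomm_ring
  rw [this, J_mul_J, mul_one]
  have : J n ℝ * Aᵀ * J n ℝ * A * J n ℝ = J n ℝ * (Aᵀ * J n ℝ * A) * J n ℝ := by noncomm_ring
  rw [this, h, J_mul_J, one_mul]

theorem gMat_inv (hA : A ∈ O1 n) :
    (gMat A)⁻¹ = Matrix.fromBlocks 1 0 0 (J n ℝ * A * J n ℝ) := by
  refine Matrix.inv_eq_right_inv ?_
  simp [gMat, Matrix.fromBlocks_multiply, O1_transpose_mul hA]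

theorem I1_inv (n : ℕ) (R : Type*) [CommRing R] : (I1 n R)⁻¹ = I1 n R := by
  refine Matrix.inv_eq_right_inv ?_
  simp [I1, Matrix.fromBlocks_multiply, J_mul_J]

theorem I0_inv (n : ℕ) (R : Type*) [CommRing R] : (I0 n R)⁻¹ = I0 n R := by
  refine Matrix.inv_eq_right_inv ?_
  simp [I0, Matrix.fromBlocks_multiply]

theorem sigma1_fromBlocks {R : Type*} [CommRing R] (a b c d : Matrix (Fin n) (Fin n) R) :
    sigma1 (Matrix.fromBlocks a b c d)
      = Matrix.fromBlocks a (-(b * J n R)) (-(J n R * c)) (J n R * d * J n R) := by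
  rw [sigma1, I1_inv, I1]
  simp [Matrix.fromBlocks_multiply]

theorem sigma0_fromBlocks {R : Type*} [CommRing R] (a b c d : Matrix (Fin n) (Fin n) R) :
    sigma0 (Matrix.fromBlocks a b c d) = Matrix.fromBlocks a (-b) (-c) d := by
  rw [sigma0, I0_inv, I0]
  simp [Matrix.fromBlocks_multiply]

theorem single_mul_J {R : Type*} [CommRing R] (i : Fin n) :
    Matrix.single i i (1 : R) * J n R = J n R * Matrix.single i i 1 := by
  ext p q
  by_cases h : p = i <;> by_cases h' : q = i <;>
    simp [J, h, h', eq_comm (a := i)]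

theorem conjA_eq (hA : A ∈ O1 n) (i : Fin n) :
    conjA A i = Matrix.fromBlocks 0 ((1 / 2 : ℝ) • (Matrix.single i i 1 * Aᵀ))
      ((1 / 2 : ℝ) • (J n ℝ * A * J n ℝ * Matrix.single i i 1)) 0 := by
  rw [conjA, gMat_inv hA, gMat, aDir]
  simp only [Matrix.fromBlocks_smul, Matrix.fromBlocks_multiply, Matrix.smul_mul, Matrix.mul_smul,
    Matrix.zero_mul, Matrix.mul_zero, Matrix.one_mul, Matrix.mul_one, smul_zero, add_zero, zero_add]

/-- The factor `(z - z⁻¹ J) / 2` of the off-diagonal blocks of the twisted connection. -/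
def twist (n : ℕ) (z : ℂ) : Matrix (Fin n) (Fin n) ℂ :=
  (1 / 2 : ℂ) • (z • 1 - z⁻¹ • J n ℂ)

/-- σ_1 multiplies the off-diagonal blocks by -J on the side facing the second summand, so the z and
z⁻¹ terms combine into one factor `twist`. -/
theorem thetaOf_eq {A : Coord n → Matrix (Fin n) (Fin n) ℝ}
    (u : Fin n → Coord n → Matrix (Fin n) (Fin n) ℝ) {x : Coord n} (hA : A x ∈ O1 n)
    (i : Fin n) (z : ℂ) :
    thetaOf A u i x z = Matrix.fromBlocks ((u i x).map Complex.ofReal)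
      (Matrix.single i i 1 * ((A x)ᵀ).map Complex.ofReal * twist n z)
      (twist n z * J n ℂ * (A x).map Complex.ofReal * (J n ℂ * Matrix.single i i 1)) 0 := by
  have hs : ∀ P : Matrix (Fin n) (Fin n) ℝ, ((1 / 2 : ℝ) • P).map Complex.ofReal
      = (1 / 2 : ℂ) • P.map Complex.ofReal := fun P => by ext; simp
  have hn : ∀ P : Matrix (Fin n) (Fin n) ℝ, (-P).map Complex.ofReal
      = -P.map Complex.ofReal := fun P => by ext; simp
  rw [thetaOf, conjA_eq hA, sigma1_fromBlocks]
  simp only [Matrix.fromBlocks_map, Matrix.fromBlocks_smul, Matrix.fromBlocks_add, hs, hn,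
    map_mul_ofReal, map_zero_ofReal, J_map, map_single_ofReal, Matrix.smul_mul, Matrix.mul_smul,
    twist, mul_sub, sub_mul, smul_sub]
  congr 1
  · simp
  · simp [smul_comm z, smul_comm z⁻¹, sub_eq_add_neg]
  · have hJ : J n ℂ * (J n ℂ * (A x).map Complex.ofReal * J n ℂ * Matrix.single i i 1)
        = J n ℂ * J n ℂ * (A x).map Complex.ofReal * (J n ℂ * Matrix.single i i 1) := by
      simp only [Matrix.mul_assoc]
    rw [hJ]
    simp [smul_comm z, smul_comm z⁻¹, sub_eq_add_neg, Matrix.mul_assoc]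
  · simp

theorem twist_sq (z : ℂ) (hz : z ≠ 0) :
    twist n z * twist n z = ((z ^ 2 + (z⁻¹) ^ 2) / 4) • 1 - (1 / 2 : ℂ) • J n ℂ := by
  simp only [twist, Matrix.smul_mul, Matrix.mul_smul, mul_sub, sub_mul, mul_one, one_mul, J_mul_J,
    smul_sub, smul_smul]
  have h : z * z⁻¹ = 1 := mul_inv_cancel₀ hz
  match_scalars
  · ring
  · linear_combination (-1 / 2 : ℂ) * h

theorem twist_eq_diagonal (z : ℂ) :
    twist n z = Matrix.diagonal fun i => (1 / 2 : ℂ) * (z - z⁻¹ * eps ℂ i) := by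
  ext i j
  by_cases h : i = j
  · subst h; simp [twist, J]
  · simp [twist, J, h]

theorem firstCoeff_eq {A : Coord n → Matrix (Fin n) (Fin n) ℝ}
    {u : Fin n → Coord n → Matrix (Fin n) (Fin n) ℝ} (i j : Fin n) (x : Coord n) :
    firstCoeff A u i j x = Matrix.single j j 1 * (pdMat i A x)ᵀ - Matrix.single i i 1 * (pdMat j A x)ᵀ
      + (u i x * Matrix.single j j 1 - u j x * Matrix.single i i 1) * (A x)ᵀ := by
  have h1 : ∀ (k : Fin n) (T : Matrix (Fin n) (Fin n) ℝ) (p q : Fin n),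
      (Matrix.single k k (1 : ℝ) * T) p q = if p = k then T k q else 0 := fun k T p q => by
    by_cases h : p = k <;> simp [Matrix.mul_apply, Matrix.single_apply, h, eq_comm (a := k)]
  ext p r
  simp only [sub_mul, Matrix.mul_assoc, Matrix.add_apply, Matrix.sub_apply, h1]
  simp [firstCoeff, Matrix.mul_apply, h1, pdMat]

end Blocks

/-! ### The curvature in block form, and what flatness at one value of z implies. -/

section Curvature

variable {n : ℕ} [NeZero n] {U : Set (Coord n)} {A : Coord n → Matrix (Fin n) (Fin n) ℝ}
  {u : Fin n → Coord n → Matrix (Fin n) (Fin n) ℝ}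

/-- By `O1_euclidean_columns` the off-diagonal entries of AᵀAJ are 2 ε_l a^1_k a^1_l; the factor 1/2
cancels the 2. -/
theorem zerothCoeff_eq {x : Coord n} (hO : A x ∈ O1 n) (i j : Fin n) :
    zerothCoeff A u i j x = pdMat i (u j) x - pdMat j (u i) x + (u i x * u j x - u j x * u i x)
      - (1 / 2 : ℝ) • (Matrix.single i i 1 * ((A x)ᵀ * A x * J n ℝ) * Matrix.single j j 1
        - Matrix.single j j 1 * ((A x)ᵀ * A x * J n ℝ) * Matrix.single i i 1) := by
  by_cases hij : i = j
  · subst hij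
    ext p q
    simp [zerothCoeff]
  have h1 : ∀ (k l : Fin n) (T : Matrix (Fin n) (Fin n) ℝ) (p q : Fin n),
      (Matrix.single k k 1 * T * Matrix.single l l 1 : Matrix (Fin n) (Fin n) ℝ) p q
        = if p = k ∧ q = l then T k l else 0 := fun k l T p q => by
    by_cases h : p = k <;> by_cases h' : q = l <;>
      simp [Matrix.mul_apply, Matrix.single_apply, h, h', eq_comm (a := k), eq_comm (a := l)]
  have h2 : ∀ k l : Fin n, k ≠ l →
      ((A x)ᵀ * A x * J n ℝ) k l = 2 * (eps ℝ l * (A x 0 k * A x 0 l)) := fun k l hkl => by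
    rw [J, Matrix.mul_diagonal, Matrix.mul_apply]
    simp only [Matrix.transpose_apply]
    rw [O1_euclidean_columns hO hkl]; ring
  ext p q
  simp only [zerothCoeff, Matrix.of_apply, Matrix.sub_apply, Matrix.add_apply, Matrix.smul_apply, h1,
    h2 i j hij, h2 j i (Ne.symm hij), Matrix.mul_apply (M := u _ x), pdMat, smul_eq_mul]
  congr 1
  split_ifs <;> ring

/-- The off-diagonal blocks carry `firstCoeff` and its transpose. In the upper left block `twist_sq`
splits the quadratic term: its z-dependent scalar part multiplies the commuting product e_i e_j and
cancels, while the -J/2 part gives the constant term of `zerothCoeff`. The lower right block cancels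
because e_i and e_j commute. -/
theorem curvature_thetaOf (hU : IsOpen U) (hA : SmoothMat U A) (hO : ∀ x ∈ U, A x ∈ O1 n)
    (hu : ∀ i, SmoothMat U (u i)) (hskew : ∀ i, ∀ x ∈ U, u i x ∈ o1 n) {x : Coord n} (hx : x ∈ U)
    {z : ℂ} (hz : z ≠ 0) (i j : Fin n) :
    pdMat i (fun y => thetaOf A u j y z) x - pdMat j (fun y => thetaOf A u i y z) x
      + (thetaOf A u i x z * thetaOf A u j x z - thetaOf A u j x z * thetaOf A u i x z)
    = Matrix.fromBlocks ((zerothCoeff A u i j x).map Complex.ofReal)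
      ((firstCoeff A u i j x).map Complex.ofReal * twist n z)
      (twist n z * J n ℂ * ((firstCoeff A u i j x)ᵀ).map Complex.ofReal * J n ℂ) 0 := by
  have hAd := fun p q => hA.differentiableAt hU hx p q
  have hpd : ∀ k l, pdMat k (fun y => thetaOf A u l y z) x
      = Matrix.fromBlocks ((pdMat k (u l) x).map Complex.ofReal)
        (Matrix.single l l 1 * ((pdMat k A x)ᵀ).map Complex.ofReal * twist n z)
        (twist n z * J n ℂ * (pdMat k A x).map Complex.ofReal * (J n ℂ * Matrix.single l l 1)) 0 := by
    intro k l
    have hc : ∀ p q, DifferentiableAt ℝ (fun y => ((A y).map Complex.ofReal) p q) x := fun p q =>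
      Complex.ofRealCLM.differentiableAt.comp x (hAd p q)
    rw [pdMat_congr hU hx (fun y hy => thetaOf_eq u (hO y hy) l z), pdMat_fromBlocks,
      pdMat_ofReal fun p q => (hu l).differentiableAt hU hx p q,
      pdMat_mul_mul _ _ (T := fun y => ((A y)ᵀ).map Complex.ofReal) fun p q => hc q p,
      pdMat_mul_mul _ _ hc, pdMat_zero, pdMat_ofReal hAd,
      pdMat_ofReal (T := fun y => (A y)ᵀ) fun p q => hAd q p]
    rfl
  have hJA : ((A x)ᵀ).map Complex.ofReal * (J n ℂ * (A x).map Complex.ofReal * J n ℂ) = 1 := by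
    have := congrArg (fun P => P.map Complex.ofReal) (O1_transpose_mul (hO x hx))
    simpa only [map_mul_ofReal, J_map, map_one_ofReal] using this
  have hsk : ∀ k, ((u k x)ᵀ).map Complex.ofReal * J n ℂ = -(J n ℂ * (u k x).map Complex.ofReal) := by
    intro k
    have := congrArg (fun P => P.map Complex.ofReal) (eq_neg_of_add_eq_zero_left (hskew k x hx))
    simp only [map_mul_ofReal, J_map] at this
    rw [this]
    ext p q
    simp [← J_map, ← map_mul_ofReal]
  have hsub : ∀ P Q : Matrix (Fin n) (Fin n) ℝ, (P - Q).map Complex.ofReal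
      = P.map Complex.ofReal - Q.map Complex.ofReal := fun P Q => by ext; simp
  have hadd : ∀ P Q : Matrix (Fin n) (Fin n) ℝ, (P + Q).map Complex.ofReal
      = P.map Complex.ofReal + Q.map Complex.ofReal := fun P Q => by ext; simp
  have hs : ∀ P : Matrix (Fin n) (Fin n) ℝ, ((1 / 2 : ℝ) • P).map Complex.ofReal
      = (1 / 2 : ℂ) • P.map Complex.ofReal := fun P => by ext; simp
  rw [hpd, hpd, thetaOf_eq u (hO x hx), thetaOf_eq u (hO x hx), firstCoeff_eq, zerothCoeff_eq (hO x hx)]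
  simp only [Matrix.fromBlocks_multiply, fromBlocks_sub, Matrix.fromBlocks_add,
    Matrix.transpose_add, Matrix.transpose_sub, Matrix.transpose_mul, Matrix.transpose_transpose,
    Matrix.transpose_single, hsub, hadd, hs, map_mul_ofReal, map_single_ofReal, J_map]
  have hE : ∀ k l : Fin n, Matrix.single k k (1 : ℂ) * Matrix.single l l 1
      = Matrix.single l l 1 * Matrix.single k k 1 := fun k l => by
    by_cases h : k = l
    · rw [h]
    · rw [Matrix.single_mul_single_of_ne _ _ _ _ h, Matrix.single_mul_single_of_ne _ _ _ _ (Ne.symm h)]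
  have hEJ : ∀ k : Fin n, Matrix.single k k (1 : ℂ) * J n ℂ = J n ℂ * Matrix.single k k 1 :=
    single_mul_J
  have hsq := twist_sq (n := n) z hz
  have hJJ := J_mul_J n ℂ
  -- What remains is an identity in a noncommutative ring with the relations collected above.
  generalize twist n z = D at *
  generalize J n ℂ = K at *
  generalize ((A x)ᵀ).map Complex.ofReal = a' at *
  generalize (A x).map Complex.ofReal = a at *
  have hEE := hE i j
  have hi := hEJ i
  have hj := hEJ j
  have ui := hsk i
  have uj := hsk j
  generalize Matrix.single i i (1 : ℂ) = ei at *
  generalize Matrix.single j j (1 : ℂ) = ej at *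
  generalize ((u i x)ᵀ).map Complex.ofReal = ui' at *
  generalize ((u j x)ᵀ).map Complex.ofReal = uj' at *
  congr 1
  · have hKL : ∀ e f : Matrix (Fin n) (Fin n) ℂ, e * a' * D * (D * K * a * (K * f))
        = ((z ^ 2 + (z⁻¹) ^ 2) / 4) • (e * f) - (1 / 2 : ℂ) • (e * (a' * a * K) * f) := by
      intro e f
      have h1 : e * a' * D * (D * K * a * (K * f)) = e * (a' * (D * D) * (K * a * K)) * f := by
        noncomm_ring
      have h2 : a' * K * (K * a * K) = a' * (K * K) * a * K := by noncomm_ring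
      rw [h1, hsq]
      simp only [mul_sub, sub_mul, Matrix.mul_smul, Matrix.smul_mul, mul_one, hJA, h2, hJJ]
    rw [hKL, hKL, hEE, smul_sub]
    abel
  · noncomm_ring
  -- Skewness exchanges the transposed u for u itself, up to moving J through.
  · have e1 : ej * ui' * K = -(K * ej * (u i x).map Complex.ofReal) := by
      rw [Matrix.mul_assoc, ui, mul_neg, ← Matrix.mul_assoc, hj]
    have e2 : ei * uj' * K = -(K * ei * (u j x).map Complex.ofReal) := by
      rw [Matrix.mul_assoc, uj, mul_neg, ← Matrix.mul_assoc, hi]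
    have e3 : ∀ P Q R : Matrix (Fin n) (Fin n) ℂ,
        D * K * (P * ej - Q * ei + R * (ej * ui' - ei * uj')) * K
        = D * K * (P * (ej * K) - Q * (ei * K) + R * (ej * ui' * K - ei * uj' * K)) := by
      intros; noncomm_ring
    rw [e3, e1, e2, hi, hj]
    noncomm_ring
  · have : ∀ P Q : Matrix (Fin n) (Fin n) ℂ,
        D * K * a * (K * P) * (Q * a' * D) = D * K * a * K * (P * Q) * a' * D := by
      intros; noncomm_ring
    rw [this, this, hEE]
    simp

theorem curvature_thetaOf_eq_zero (hU : IsOpen U) (hA : SmoothMat U A) (hO : ∀ x ∈ U, A x ∈ O1 n)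
    (h : LaxSystem U A u) {x : Coord n} (hx : x ∈ U) {z : ℂ} (hz : z ≠ 0) (i j : Fin n) :
    pdMat i (fun y => thetaOf A u j y z) x - pdMat j (fun y => thetaOf A u i y z) x
      + (thetaOf A u i x z * thetaOf A u j x z - thetaOf A u j x z * thetaOf A u i x z) = 0 := by
  rw [curvature_thetaOf hU hA hO h.smooth h.skew hx hz, h.first x hx, h.zeroth x hx]
  simp

/-- Only flatness is needed, and only at one real t with 1 < t < 1/ε: there both diagonal factors (t
± t⁻¹)/2 are nonzero, so `firstCoeff` can be divided out. -/
theorem SolvesTwisted.laxSystem {ε : ℝ} (hε₀ : 0 < ε) (hε₁ : ε < 1) (hU : IsOpen U)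
    (h : SolvesTwisted ε U A u) : LaxSystem U A u := by
  obtain ⟨hA, hu, hO, hskew, M, -, -, -, hflat⟩ := h
  obtain ⟨t, ht1, ht2⟩ := exists_between ((one_lt_div hε₀).2 hε₁)
  have ht0 : (0 : ℝ) < t := by linarith
  have htann : (t : ℂ) ∈ annulus ε := by
    simp only [annulus, Set.mem_ofPred_eq, Complex.norm_real, Real.norm_eq_abs, abs_of_pos ht0]
    exact ⟨by linarith, ht2⟩
  have htc : (t : ℂ) ≠ 0 := by exact_mod_cast ht0.ne'
  have key : ∀ x ∈ U, ∀ i j, zerothCoeff A u i j x = 0 ∧ firstCoeff A u i j x = 0 := by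
    intro x hx i j
    have := hflat i j x hx t htann
    rw [curvature_thetaOf hU hA hO hu hskew hx htc, ← Matrix.fromBlocks_zero,
      Matrix.fromBlocks_inj] at this
    refine ⟨?_, ?_⟩
    · ext p q
      simpa using congrFun (congrFun this.1 p) q
    · ext p q
      have h2 := congrFun (congrFun this.2.1 p) q
      rw [twist_eq_diagonal, Matrix.mul_diagonal] at h2
      have hne : (1 / 2 : ℂ) * (t - (t : ℂ)⁻¹ * eps ℂ q) ≠ 0 := by
        have ht3 : t⁻¹ < t := (inv_lt_one_of_one_lt₀ ht1).trans ht1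
        have ht4 : (0 : ℝ) < t⁻¹ := inv_pos.2 ht0
        refine mul_ne_zero (by norm_num) ?_
        unfold eps
        split_ifs
        · have : t - t⁻¹ * (-1) ≠ 0 := by nlinarith
          exact_mod_cast this
        · have : t - t⁻¹ * 1 ≠ 0 := by nlinarith
          exact_mod_cast this
      simpa [hne] using (mul_eq_zero.1 h2).resolve_right hne
  exact ⟨hu, hskew, fun x hx i j => (key x hx i j).2, fun x hx i j => (key x hx i j).1⟩

end Curvature

/-! ## The dressing loop -/

section MatrixExponential

open NormedSpace
open scoped Nat

/-- Taylor expansion at `0` of `exp (w P) (S + w² T) exp (-w P)` in a Banach algebra. -/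
theorem exists_hasSum_exp_conj {𝔸 : Type*} [NormedRing 𝔸] [NormedAlgebra ℂ 𝔸] [CompleteSpace 𝔸]
    (P S T : 𝔸) : ∃ c : ℕ → 𝔸, c 0 = S ∧ c 1 = P * S - S * P ∧
      ∀ w : ℂ, HasSum (fun k => w ^ k • c k) (exp (w • P) * (S + w ^ 2 • T) * exp (-(w • P))) := by
  set f : ℂ → 𝔸 := fun w => exp (w • P) * (S + w ^ 2 • T) * exp (w • -P) with hf
  have hd : ∀ w, HasDerivAt f
      ((exp (w • P) * P * (S + w ^ 2 • T) + exp (w • P) * ((2 * w) • T)) * exp (w • -P)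
        + exp (w • P) * (S + w ^ 2 • T) * (exp (w • -P) * -P)) w := by
    intro w
    have h1 := hasDerivAt_exp_smul_const (𝕂 := ℂ) P w
    have h2 : HasDerivAt (fun w : ℂ => S + w ^ 2 • T) ((2 * w) • T) w := by
      have := ((hasDerivAt_pow 2 w).smul_const T).const_add S
      simpa using this
    exact (h1.mul h2).mul (hasDerivAt_exp_smul_const (𝕂 := ℂ) (-P) w)
  have hfd : Differentiable ℂ f := fun w => (hd w).differentiableAt
  refine ⟨fun k => (k ! : ℂ)⁻¹ • iteratedDeriv k f 0, ?_, ?_, fun w => ?_⟩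
  · simp [hf]
  · have := (hd 0).deriv
    simp [iteratedDeriv_one, this]
    abel
  -- The conjugate is entire in w, so its Taylor series at 0 converges everywhere.
  · have := Complex.hasSum_taylorSeries_of_entire hfd 0 w
    rw [← smul_neg]
    refine this.congr_fun fun k => ?_
    rw [sub_zero, smul_comm]

variable {ι : Type*} [Fintype ι] [DecidableEq ι]

open scoped Matrix.Norms.Operator in
theorem exists_hasSum_matrix_exp_conj (P S T : Matrix ι ι ℂ) : ∃ c : ℕ → Matrix ι ι ℂ, c 0 = S ∧
    c 1 = P * S - S * P ∧ ∀ w : ℂ,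
      HasSum (fun k => w ^ k • c k) (exp (w • P) * (S + w ^ 2 • T) * exp (-(w • P))) :=
  exists_hasSum_exp_conj P S T

theorem differentiable_matrix_exp_smul (P : Matrix ι ι ℂ) (p q : ι) :
    Differentiable ℂ fun w : ℂ => exp (w • P) p q := by
  open scoped Matrix.Norms.Operator in
  intro w
  have h := (hasDerivAt_exp_smul_const (𝕂 := ℂ) P w).differentiableAt
  exact (LinearMap.toContinuousLinearMap (Matrix.entryLinearMap ℂ ℂ p q)).differentiableAt.comp w h

theorem smoothMat_exp {n : ℕ} {U : Set (Coord n)} {T : Coord n → Matrix ι ι ℂ}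
    (hT : SmoothMat U T) : SmoothMat U fun x => exp (T x) := by
  open scoped Matrix.Norms.Operator in
  have hT' : ContDiffOn ℝ ∞ T U := by
    have : T = fun x => ∑ p, ∑ q, T x p q • Matrix.single p q (1 : ℂ) := by
      funext x
      conv_lhs => rw [Matrix.matrix_eq_sum_single (T x)]
      simp
    rw [this]
    exact ContDiffOn.sum fun p _ => ContDiffOn.sum fun q _ => (hT p q).smul contDiffOn_const
  have hexp : ContDiff ℝ ∞ (exp : Matrix ι ι ℂ → Matrix ι ι ℂ) :=
    contDiff_iff_contDiffAt.2 fun y => (exp_analytic (𝕂 := ℝ) y).contDiffAt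
  intro p q
  exact (LinearMap.toContinuousLinearMap (Matrix.entryLinearMap ℝ ℂ p q)).contDiff.comp_contDiffOn
    (hexp.comp_contDiffOn hT')

theorem continuous_matrix_exp : Continuous (exp : Matrix ι ι ℂ → Matrix ι ι ℂ) := by
  open scoped Matrix.Norms.Operator in
  exact exp_continuous

end MatrixExponential

/-! ### Membership of the explicit loop in the negative loop group, and its projection. -/

section Dressing

open NormedSpace

variable {n : ℕ}

/-- The element `[[0, J qᵗ J], [q, 0]]` of the Lie algebra of `O(J,J)`. -/
def offBlock (q : Matrix (Fin n) (Fin n) ℝ) : Mat2 n ℝ :=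
  Matrix.fromBlocks 0 (J n ℝ * qᵀ * J n ℝ) q 0

/-- The loop `exp (z⁻¹ P) diag(1, C)`, with `P` as in `offBlock`. -/
def dressing (q C : Matrix (Fin n) (Fin n) ℝ) (z : ℂ) : Mat2 n ℂ :=
  exp (z⁻¹ • (offBlock q).map Complex.ofReal) *
    (Matrix.fromBlocks 1 0 0 C : Mat2 n ℝ).map Complex.ofReal

theorem Jt_mul_Jt (n : ℕ) (R : Type*) [CommRing R] : Jt n R * Jt n R = 1 := by
  simp [Jt, Matrix.fromBlocks_multiply, J_mul_J]

theorem Jt_map (n : ℕ) : (Jt n ℝ).map Complex.ofReal = Jt n ℂ := by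
  have : (-(J n ℝ)).map Complex.ofReal = -(J n ℂ) := by
    rw [← J_map]; ext; simp
  simp [Jt, Matrix.fromBlocks_map, J_map, this]

theorem offBlock_skew (q : Matrix (Fin n) (Fin n) ℝ) :
    (offBlock q)ᵀ = Jt n ℝ * -(offBlock q) * Jt n ℝ := by
  have h : J n ℝ * (J n ℝ * qᵀ * J n ℝ) * J n ℝ = J n ℝ * J n ℝ * qᵀ * (J n ℝ * J n ℝ) := by
    noncomm_ring
  rw [J_mul_J] at h
  simp [offBlock, Jt, Matrix.fromBlocks_multiply, Matrix.fromBlocks_transpose,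
    Matrix.fromBlocks_neg, J_transpose, Matrix.mul_assoc] at h ⊢
  exact h.symm

theorem map_conj_ofReal {ι : Type*} (T : Matrix ι ι ℝ) :
    (T.map Complex.ofReal).map (starRingEnd ℂ) = T.map Complex.ofReal := by
  ext; simp

theorem dressing_conj (q C : Matrix (Fin n) (Fin n) ℝ) (z : ℂ) :
    (dressing q C (starRingEnd ℂ z)).map (starRingEnd ℂ) = dressing q C z := by
  have hstar : ∀ X : Mat2 n ℂ, (exp X).map (starRingEnd ℂ) = exp (X.map (starRingEnd ℂ)) := by
    intro X
    -- Entrywise conjugation is adjoint followed by transpose, and both commute with exp.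
    have h1 : ∀ Y : Mat2 n ℂ, Y.map (starRingEnd ℂ) = Yᴴᵀ := fun Y => rfl
    rw [h1, h1, ← Matrix.exp_conjTranspose, ← Matrix.exp_transpose]
  rw [dressing, dressing, Matrix.map_mul, hstar, map_conj_ofReal]
  congr 2
  ext p r
  simp

/-- P is skew for J̃, so transposing exp(z⁻¹P) gives its inverse conjugated by J̃; the constant
factor preserves J̃ because C preserves J. -/
theorem dressing_orthogonal (q : Matrix (Fin n) (Fin n) ℝ) {C : Matrix (Fin n) (Fin n) ℝ}
    (hC : C ∈ O1 n) (z : ℂ) : (dressing q C z)ᵀ * Jt n ℂ * dressing q C z = Jt n ℂ := by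
  set P : Mat2 n ℂ := (offBlock q).map Complex.ofReal with hP
  set B : Mat2 n ℂ := (Matrix.fromBlocks 1 0 0 C : Mat2 n ℝ).map Complex.ofReal with hB
  have hPt : Pᵀ = Jt n ℂ * -P * Jt n ℂ := by
    have := congrArg (fun X => X.map Complex.ofReal) (offBlock_skew q)
    simp only [map_mul_ofReal, Jt_map] at this
    rw [hP, ← Matrix.transpose_map]
    refine this.trans ?_
    congr 2
    ext; simp
  have hBt : Bᵀ * Jt n ℂ * B = Jt n ℂ := by
    have h : (Matrix.fromBlocks 1 0 0 C : Mat2 n ℝ)ᵀ * Jt n ℝ * Matrix.fromBlocks 1 0 0 C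
        = Jt n ℝ := by
      have : Cᵀ * J n ℝ * C = J n ℝ := hC
      simp [Jt, Matrix.fromBlocks_multiply, Matrix.fromBlocks_transpose, this]
    have := congrArg (fun X => X.map Complex.ofReal) h
    simpa only [map_mul_ofReal, Jt_map, Matrix.transpose_map] using this
  have hJu : IsUnit (Jt n ℂ) := IsUnit.of_mul_eq_one _ (Jt_mul_Jt n ℂ)
  have hJi : (Jt n ℂ)⁻¹ = Jt n ℂ := Matrix.inv_eq_right_inv (Jt_mul_Jt n ℂ)
  have hE : (exp (z⁻¹ • P))ᵀ = Jt n ℂ * exp (-(z⁻¹ • P)) * Jt n ℂ := by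
    rw [← Matrix.exp_transpose, Matrix.transpose_smul, hPt]
    have h1 : z⁻¹ • (Jt n ℂ * -P * Jt n ℂ) = Jt n ℂ * -(z⁻¹ • P) * (Jt n ℂ)⁻¹ := by
      rw [hJi]; simp
    rw [h1, Matrix.exp_conj _ _ hJu, hJi]
  have hinv : exp (-(z⁻¹ • P)) * exp (z⁻¹ • P) = 1 := by
    rw [← Matrix.exp_add_of_commute _ _ (Commute.refl (z⁻¹ • P)).neg_left, neg_add_cancel, exp_zero]
  change (exp (z⁻¹ • P) * B)ᵀ * Jt n ℂ * (exp (z⁻¹ • P) * B) = Jt n ℂ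
  rw [Matrix.transpose_mul, hE]
  have : Bᵀ * (Jt n ℂ * exp (-(z⁻¹ • P)) * Jt n ℂ) * Jt n ℂ * (exp (z⁻¹ • P) * B)
      = Bᵀ * Jt n ℂ * (exp (-(z⁻¹ • P)) * (Jt n ℂ * Jt n ℂ) * exp (z⁻¹ • P)) * B := by
    noncomm_ring
  rw [this, Jt_mul_Jt, mul_one, hinv, mul_one, hBt]

theorem isUnit_det_dressing (q : Matrix (Fin n) (Fin n) ℝ) {C : Matrix (Fin n) (Fin n) ℝ}
    (hC : C ∈ O1 n) (z : ℂ) : IsUnit (dressing q C z).det := by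
  refine Matrix.isUnit_det_of_left_inverse (B := Jt n ℂ * ((dressing q C z)ᵀ * Jt n ℂ)) ?_
  rw [Matrix.mul_assoc, dressing_orthogonal q hC, Jt_mul_Jt]

/-- σ_0 negates the off-diagonal P, which undoes z ↦ -z, and fixes the block diagonal factor. -/
theorem sigma0_dressing (q C : Matrix (Fin n) (Fin n) ℝ) (z : ℂ) :
    sigma0 (dressing q C (-z)) = dressing q C z := by
  have hI2 : I0 n ℂ * I0 n ℂ = 1 := by simp [I0, Matrix.fromBlocks_multiply]
  have hIu : IsUnit (I0 n ℂ) := IsUnit.of_mul_eq_one _ hI2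
  have hmul : ∀ X Y : Mat2 n ℂ, sigma0 (X * Y) = sigma0 X * sigma0 Y := by
    intro X Y
    have : I0 n ℂ * X * I0 n ℂ * (I0 n ℂ * Y * I0 n ℂ)
        = I0 n ℂ * X * (I0 n ℂ * I0 n ℂ) * Y * I0 n ℂ := by noncomm_ring
    rw [sigma0, sigma0, sigma0, I0_inv, this, hI2, mul_one]
    noncomm_ring
  have hexp : ∀ X : Mat2 n ℂ, sigma0 (exp X) = exp (sigma0 X) := fun X =>
    (Matrix.exp_conj _ _ hIu).symm
  rw [dressing, dressing, hmul, hexp, offBlock, inv_neg, neg_smul]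
  simp only [Matrix.fromBlocks_neg, Matrix.fromBlocks_map, Matrix.fromBlocks_smul, sigma0_fromBlocks, map_zero_ofReal,
    neg_zero, smul_zero, neg_neg]

theorem dressing_mem_LMinus {ε : ℝ} (hε₀ : 0 < ε) (q : Matrix (Fin n) (Fin n) ℝ)
    {C : Matrix (Fin n) (Fin n) ℝ} (hC : C ∈ O1 n) : dressing q C ∈ LMinus n ε := by
  have hdiff : ∀ p r, DifferentiableOn ℂ (fun z => dressing q C z p r) (exterior ε) := by
    intro p r z hz
    have hz0 : z ≠ 0 := fun h => by
      subst h
      simp only [exterior, Set.mem_ofPred_eq, norm_zero] at hz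
      linarith
    simp only [dressing, Matrix.mul_apply]
    refine (DifferentiableAt.fun_sum fun k _ => DifferentiableAt.mul_const ?_ _).differentiableWithinAt
    exact (differentiable_matrix_exp_smul _ p k _).comp z (differentiableAt_inv hz0)
  refine ⟨⟨fun p r => (hdiff p r).mono fun z hz => hz.1, fun z _ =>
    ⟨isUnit_det_dressing q hC z, ?_, dressing_conj q C z, sigma0_dressing q C z⟩⟩, hdiff,
    fun z _ => isUnit_det_dressing q hC z, _, ⟨C, hC, rfl⟩, ?_⟩
  -- By the reality condition, the Hermitian condition at z̄ becomes complex orthogonality at z.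
  · have h1 : ∀ Y : Mat2 n ℂ, Yᴴ = (Y.map (starRingEnd ℂ))ᵀ := fun Y => rfl
    rw [h1, dressing_conj, dressing_orthogonal q hC]
  -- The exponent tends to 0 at infinity, which leaves diag(1, C) in K_0'.
  · have h1 : Filter.Tendsto (fun z : ℂ => z⁻¹ • (offBlock q).map Complex.ofReal)
        (Bornology.cobounded ℂ) (nhds 0) := by
      have := (Filter.tendsto_inv₀_cobounded (α := ℂ)).smul_const ((offBlock q).map Complex.ofReal)
      rwa [zero_smul] at this
    have h2 := (continuous_matrix_exp.tendsto (0 : Mat2 n ℂ)).comp h1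
    rw [exp_zero] at h2
    have h3 := h2.mul_const ((Matrix.fromBlocks 1 0 0 C : Mat2 n ℝ).map Complex.ofReal)
    rw [one_mul, Matrix.fromBlocks_map, map_one_ofReal, map_zero_ofReal] at h3
    refine h3.congr fun z => ?_
    rw [dressing, Matrix.fromBlocks_map, map_one_ofReal, map_zero_ofReal]
    rfl

theorem SmoothMat.mul {ι 𝔸 : Type*} [Fintype ι] [NormedRing 𝔸] [NormedAlgebra ℝ 𝔸]
    {U : Set (Coord n)} {S T : Coord n → Matrix ι ι 𝔸} (hS : SmoothMat U S) (hT : SmoothMat U T) :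
    SmoothMat U fun x => S x * T x := fun p q => by
  simp only [Matrix.mul_apply]
  exact ContDiffOn.sum fun k _ => (hS p k).mul (hT k q)

theorem SmoothMat.const {ι F : Type*} [NormedAddCommGroup F] [NormedSpace ℝ F]
    {U : Set (Coord n)} (T : Matrix ι ι F) : SmoothMat U fun _ => T := fun _ _ => contDiffOn_const

theorem SmoothMat.fromBlocks {F : Type*} [NormedAddCommGroup F] [NormedSpace ℝ F]
    {U : Set (Coord n)} {a b c d : Coord n → Matrix (Fin n) (Fin n) F} (ha : SmoothMat U a)
    (hb : SmoothMat U b) (hc : SmoothMat U c) (hd : SmoothMat U d) :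
    SmoothMat U fun x => Matrix.fromBlocks (a x) (b x) (c x) (d x) := by
  rintro (p | p) (q | q)
  exacts [ha p q, hb p q, hc p q, hd p q]

theorem SmoothMat.ofReal {ι : Type*} {U : Set (Coord n)} {T : Coord n → Matrix ι ι ℝ}
    (hT : SmoothMat U T) : SmoothMat U fun x => (T x).map Complex.ofReal := fun p q =>
  Complex.ofRealCLM.contDiff.comp_contDiffOn (hT p q)

theorem smooth_dressing {U : Set (Coord n)} {q C : Coord n → Matrix (Fin n) (Fin n) ℝ}
    (hq : SmoothMat U q) (hC : SmoothMat U C) (z : ℂ) :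
    SmoothMat U fun x => dressing (q x) (C x) z := by
  have hz : SmoothMat U fun _ : Coord n => (0 : Matrix (Fin n) (Fin n) ℝ) := SmoothMat.const 0
  have hP : SmoothMat U fun x => (offBlock (q x)).map Complex.ofReal :=
    (SmoothMat.fromBlocks hz
      (((SmoothMat.const (J n ℝ)).mul fun p r => hq r p).mul (SmoothMat.const (J n ℝ))) hq hz).ofReal
  refine SmoothMat.mul (smoothMat_exp fun p r => ?_)
    (SmoothMat.fromBlocks (SmoothMat.const 1) hz hz hC).ofReal
  exact (hP p r).const_smul z⁻¹

/-- This fixes the choice of P: the lower left block -2 J A J F cancels the 1/2 in a_i and the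
inverse of `Aᵀ`, and its sign matches that of the commutator. -/
theorem toBlocks₁₁_commutator_conjA {A : Matrix (Fin n) (Fin n) ℝ} (hA : A ∈ O1 n)
    (F : Matrix (Fin n) (Fin n) ℝ) (i : Fin n) :
    (offBlock ((-2 : ℝ) • (J n ℝ * A * J n ℝ * F)) * conjA A i
      - conjA A i * offBlock ((-2 : ℝ) • (J n ℝ * A * J n ℝ * F))).toBlocks₁₁ = connOf F i := by
  have h1 : J n ℝ * (J n ℝ * A * J n ℝ * F)ᵀ * J n ℝ * (J n ℝ * A * J n ℝ * Matrix.single i i 1)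
      = J n ℝ * Fᵀ * Matrix.single i i 1 * J n ℝ := by
    have : J n ℝ * (J n ℝ * A * J n ℝ * F)ᵀ * J n ℝ * (J n ℝ * A * J n ℝ * Matrix.single i i 1)
        = J n ℝ * Fᵀ * J n ℝ * Aᵀ * (J n ℝ * J n ℝ) * (J n ℝ * A * J n ℝ) * Matrix.single i i 1 := by
      simp only [Matrix.transpose_mul, J_transpose]
      noncomm_ring
    rw [this, J_mul_J, mul_one, Matrix.mul_assoc (J n ℝ * Fᵀ * J n ℝ), O1_transpose_mul hA, mul_one,
      Matrix.mul_assoc _ (J n ℝ), ← single_mul_J, Matrix.mul_assoc _ _ (J n ℝ)]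
  have h2 : Matrix.single i i 1 * Aᵀ * (J n ℝ * A * J n ℝ * F) = Matrix.single i i 1 * F := by
    rw [Matrix.mul_assoc, ← Matrix.mul_assoc Aᵀ, O1_transpose_mul hA, one_mul]
  have h3 : ∀ X Y : Mat2 n ℝ, (X - Y).toBlocks₁₁ = X.toBlocks₁₁ - Y.toBlocks₁₁ := fun _ _ => rfl
  rw [conjA_eq hA, offBlock, h3, Matrix.fromBlocks_multiply, Matrix.fromBlocks_multiply,
    Matrix.toBlocks_fromBlocks₁₁, Matrix.toBlocks_fromBlocks₁₁, connOf, ← h1, ← h2]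
  simp only [Matrix.transpose_smul, Matrix.mul_smul, Matrix.smul_mul, zero_mul, zero_add, smul_smul]
  norm_num
  abel

/-- The conjugated loop expands as z S + [P,S] + O(z⁻¹) with S = b a_i b⁻¹, and π̂_+ ignores the
negative powers. -/
theorem isPiPlus_dressing {ε : ℝ} (hε₀ : 0 < ε) {A : Coord n → Matrix (Fin n) (Fin n) ℝ}
    (F : Coord n → Matrix (Fin n) (Fin n) ℝ) {u : Fin n → Coord n → Matrix (Fin n) (Fin n) ℝ}
    {x : Coord n} (hA : A x ∈ O1 n) {i : Fin n} (hu : u i x = connOf (F x) i) :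
    IsPiPlus ε
      (fun z => dressing ((-2 : ℝ) • (J n ℝ * A x * J n ℝ * F x)) (J n ℝ * A x * J n ℝ) z *
        Jloop (aDir ℂ i) z *
        (dressing ((-2 : ℝ) • (J n ℝ * A x * J n ℝ * F x)) (J n ℝ * A x * J n ℝ) z)⁻¹)
      (thetaOf A u i x) := by
  set q := (-2 : ℝ) • (J n ℝ * A x * J n ℝ * F x) with hq
  set P : Mat2 n ℂ := (offBlock q).map Complex.ofReal with hP
  set B : Mat2 n ℂ :=
    (Matrix.fromBlocks 1 0 0 (J n ℝ * A x * J n ℝ) : Mat2 n ℝ).map Complex.ofReal with hB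
  have hB' : B = ((gMat (A x))⁻¹).map Complex.ofReal := by rw [gMat_inv hA]
  have hBg : B * (gMat (A x)).map Complex.ofReal = 1 := by
    have h : (gMat (A x))⁻¹ * gMat (A x) = 1 := by
      rw [gMat_inv hA]
      simp [gMat, Matrix.fromBlocks_multiply, O1_mul_transpose hA]
    rw [hB', ← map_mul_ofReal, h, map_one_ofReal]
  have hBi : B⁻¹ = (gMat (A x)).map Complex.ofReal := Matrix.inv_eq_right_inv hBg
  have haC : aDir ℂ i = (aDir ℝ i : Mat2 n ℝ).map Complex.ofReal := by
    have hs : ∀ T : Mat2 n ℝ, ((1 / 2 : ℝ) • T).map Complex.ofReal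
      = (1 / 2 : ℂ) • T.map Complex.ofReal := fun T => by ext; simp
    rw [aDir, aDir, hs, Matrix.fromBlocks_map, map_zero_ofReal, map_single_ofReal]
  set S : Mat2 n ℂ := (conjA (A x) i).map Complex.ofReal with hS
  have hSB : B * aDir ℂ i * B⁻¹ = S := by
    rw [hBi, haC, hB', hS, conjA, map_mul_ofReal, map_mul_ofReal]
  obtain ⟨d, hd0, hd1, hd⟩ := exists_hasSum_matrix_exp_conj P S (B * sigma1 (aDir ℂ i) * B⁻¹)
  have hsum : ∀ z : ℂ, z ≠ 0 → HasSum (fun k : ℕ => z ^ (1 - k : ℤ) • d k)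
      (dressing q (J n ℝ * A x * J n ℝ) z * Jloop (aDir ℂ i) z *
        (dressing q (J n ℝ * A x * J n ℝ) z)⁻¹) := by
    intro z hz
    -- Here w = z⁻¹, since J_{a,1} = z (a + w² σ_1(a)).
    have h1 := (hd z⁻¹).const_smul z
    have h2 : z • (exp (z⁻¹ • P) * (S + z⁻¹ ^ 2 • (B * sigma1 (aDir ℂ i) * B⁻¹)) *
        exp (-(z⁻¹ • P))) = dressing q (J n ℝ * A x * J n ℝ) z * Jloop (aDir ℂ i) z *
        (dressing q (J n ℝ * A x * J n ℝ) z)⁻¹ := by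
      have h3 : dressing q (J n ℝ * A x * J n ℝ) z = exp (z⁻¹ • P) * B := rfl
      have h4 : z * z⁻¹ ^ 2 = z⁻¹ := by field_simp
      rw [h3, Matrix.mul_inv_rev, Matrix.exp_neg, ← hSB, Jloop]
      simp only [mul_add, add_mul, Matrix.mul_smul, Matrix.smul_mul, smul_add, smul_smul, h4,
        Matrix.mul_assoc]
    rw [h2] at h1
    refine h1.congr_fun fun k => ?_
    rw [smul_smul, zpow_sub₀ hz, zpow_one, zpow_natCast, inv_pow, div_eq_mul_inv]
  have hne : ∀ z ∈ annulus ε, z ≠ 0 := fun z hz h => by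
    have := hz.1
    rw [h, norm_zero] at this
    linarith
  -- The prefactor z shifts the Taylor index: the Laurent coefficient of z^j is d_{1-j}, so N = 1.
  refine ⟨1, fun j => if j ≤ 1 then d (1 - j).toNat else 0, fun z hz => ?_, fun j hj => ?_,
    fun z hz => ?_⟩
  · have hinj : Function.Injective fun k : ℕ => (1 - k : ℤ) := fun a b h => by
      simp only at h; omega
    refine (hinj.hasSum_iff fun j hj => ?_).1 ?_
    · have : ¬ j ≤ 1 := fun h => hj ⟨(1 - j).toNat, by simp only; omega⟩
      simp [this]
    · refine (hsum z (hne z hz)).congr_fun fun k => ?_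
      have h1 : (1 - k : ℤ) ≤ 1 := by omega
      simp [h1]
  · have : ¬ j ≤ 1 := by push_cast at hj; omega
    simp [this]
  -- No even j satisfies 0 < j ≤ 1, so the 𝒮_1 correction is absent.
  · have hfil : (Finset.Icc 1 1).filter (fun j : ℕ => Even j) = ∅ := by decide
    have hpi1 : piS1 (0 : Mat2 n ℂ) = 0 := by
      ext (p | p) (r | r) <;> simp [piS1, Matrix.toBlocks₂₂]
    have hsig : sigma1 S = (sigma1 (conjA (A x) i)).map Complex.ofReal := by
      have hI : (I1 n ℝ).map Complex.ofReal = I1 n ℂ := by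
        have : (-1 : Matrix (Fin n) (Fin n) ℝ).map Complex.ofReal = -1 := by
          ext p r; by_cases h : p = r <;> simp [h]
        rw [I1, Matrix.fromBlocks_map, J_map, map_zero_ofReal, this]; rfl
      rw [sigma1, sigma1, I1_inv, I1_inv, map_mul_ofReal, map_mul_ofReal, hI]
    have hc0 : piS0 (P * S - S * P)
        = (Matrix.fromBlocks (u i x) 0 0 0 : Mat2 n ℝ).map Complex.ofReal := by
      have h1 : P * S - S * P
          = (offBlock q * conjA (A x) i - conjA (A x) i * offBlock q).map Complex.ofReal := by
        rw [hP, hS, ← map_mul_ofReal, ← map_mul_ofReal]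
        ext; simp
      have h2 := toBlocks₁₁_commutator_conjA hA (F x) i
      rw [← hq, ← hu] at h2
      ext (p | p) (r | r)
      · rw [h1, ← h2]
        rfl
      all_goals simp [piS0]
    rw [piPlus, hfil, Finset.sum_empty, hpi1, sub_zero]
    simp only [Finset.Icc_self, Finset.sum_singleton, pow_one, Nat.cast_one]
    have e0 : (1 - 0 : ℤ).toNat = 1 := rfl
    have e1 : (1 - 1 : ℤ).toNat = 0 := rfl
    rw [if_pos le_rfl, if_pos zero_le_one, e0, e1, hd0, hd1, hsig, hc0, thetaOf, hS]
    abel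

theorem LaxSystem.solvesTwisted [NeZero n] {ε : ℝ} (hε₀ : 0 < ε) {U : Set (Coord n)}
    (hU : IsOpen U) {A : Coord n → Matrix (Fin n) (Fin n) ℝ} (hA : SmoothMat U A)
    (hO : ∀ x ∈ U, A x ∈ O1 n) {u : Fin n → Coord n → Matrix (Fin n) (Fin n) ℝ}
    (h : LaxSystem U A u) : SolvesTwisted ε U A u := by
  have hF := (h.genSinhGordon hU hA hO).smoothF
  have hC : SmoothMat U fun x => J n ℝ * A x * J n ℝ :=
    ((SmoothMat.const _).mul hA).mul (SmoothMat.const _)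
  have hq : SmoothMat U fun x => (-2 : ℝ) • (J n ℝ * A x * J n ℝ * offDiag u x) := fun p r =>
    ((hC.mul hF) p r).const_smul (-2 : ℝ)
  refine ⟨hA, h.smooth, hO, h.skew, fun x z =>
    dressing ((-2 : ℝ) • (J n ℝ * A x * J n ℝ * offDiag u x)) (J n ℝ * A x * J n ℝ) z,
    fun x hx => dressing_mem_LMinus hε₀ _ (O1_inverse_transpose_mem (hO x hx)),
    fun z _ => smooth_dressing hq hC z,
    fun i x hx => isPiPlus_dressing hε₀ (offDiag u) (hO x hx) (h.eq_connOf hO i hx),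
    fun i j x hx z hz => curvature_thetaOf_eq_zero hU hA hO h hx (fun hz0 => ?_) i j⟩
  have := hz.1
  rw [hz0, norm_zero] at this
  linarith

end Dressing

/-! ## Time-like submanifolds -/

section Submanifold

variable {n : ℕ} {U : Set (Coord n)} {x : Coord n}

theorem mink_comm (v w : Ambient n) : mink v w = mink w v :=
  Finset.sum_congr rfl fun i _ => by ring

theorem mink_add_left (u v w : Ambient n) : mink (u + v) w = mink u w + mink v w := by
  simp only [mink, ← Finset.sum_add_distrib, Pi.add_apply]
  exact Finset.sum_congr rfl fun i _ => by ring

theorem mink_smul_left (c : ℝ) (v w : Ambient n) : mink (c • v) w = c * mink v w := by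
  simp only [mink, Finset.mul_sum, Pi.smul_apply, smul_eq_mul]
  exact Finset.sum_congr rfl fun i _ => by ring

theorem mink_smul_right (c : ℝ) (v w : Ambient n) : mink v (c • w) = c * mink v w := by
  rw [mink_comm, mink_smul_left, mink_comm]

theorem pd_apply {ι : Type*} [Fintype ι] {f : Coord n → ι → ℝ} (hf : DifferentiableAt ℝ f x)
    (i : Fin n) (a : ι) : pd i (fun y => f y a) x = pd i f x a :=
  pd_clm (ContinuousLinearMap.proj (R := ℝ) (φ := fun _ : ι => ℝ) a) hf i

theorem pd_mul {f g : Coord n → ℝ} (hf : DifferentiableAt ℝ f x) (hg : DifferentiableAt ℝ g x)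
    (i : Fin n) : pd i (fun y => f y * g y) x = pd i f x * g x + f x * pd i g x := by
  simp only [pd]
  rw [fderiv_fun_mul hf hg]
  simp; ring

theorem pd_smul {F : Type*} [NormedAddCommGroup F] [NormedSpace ℝ F] {f : Coord n → ℝ}
    {g : Coord n → F} (hf : DifferentiableAt ℝ f x) (hg : DifferentiableAt ℝ g x) (i : Fin n) :
    pd i (fun y => f y • g y) x = pd i f x • g x + f x • pd i g x := by
  simp only [pd]
  rw [fderiv_fun_smul hf hg]
  simp [add_comm]

theorem pd_mink {f g : Coord n → Ambient n} (hf : DifferentiableAt ℝ f x)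
    (hg : DifferentiableAt ℝ g x) (i : Fin n) :
    pd i (fun y => mink (f y) (g y)) x = mink (pd i f x) (g x) + mink (f x) (pd i g x) := by
  have hf' := differentiableAt_pi.1 hf
  have hg' := differentiableAt_pi.1 hg
  simp only [mink, ← Finset.sum_add_distrib]
  rw [pd_sum fun a _ => ((hf' a).const_mul _).fun_mul (hg' a)]
  refine Finset.sum_congr rfl fun a _ => ?_
  rw [pd_mul ((hf' a).const_mul _) (hg' a), pd_const_mul (hf' a), pd_apply hf, pd_apply hg]

theorem contDiffOn_mink {f g : Coord n → Ambient n} (hf : ContDiffOn ℝ ∞ f U)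
    (hg : ContDiffOn ℝ ∞ g U) : ContDiffOn ℝ ∞ (fun y => mink (f y) (g y)) U :=
  ContDiffOn.sum fun a _ => (contDiffOn_const.mul (contDiffOn_pi.1 hf a)).mul (contDiffOn_pi.1 hg a)

theorem contDiffOn_pd {F : Type*} [NormedAddCommGroup F] [NormedSpace ℝ F] (hU : IsOpen U)
    {f : Coord n → F} (hf : ContDiffOn ℝ ∞ f U) (i : Fin n) : ContDiffOn ℝ ∞ (pd i f) U :=
  (hf.fderiv_of_isOpen hU (by simp)).clm_apply contDiffOn_const

theorem pd_pd_comm {F : Type*} [NormedAddCommGroup F] [NormedSpace ℝ F] (hU : IsOpen U)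
    {f : Coord n → F} (hf : ContDiffOn ℝ ∞ f U) (hx : x ∈ U) (i j : Fin n) :
    pd i (pd j f) x = pd j (pd i f) x := by
  have hd : DifferentiableAt ℝ (fderiv ℝ f) x :=
    differentiableAt_of_smooth hU hx (hf.fderiv_of_isOpen hU (by simp))
  have h : ∀ k l : Fin n, pd k (pd l f) x
      = fderiv ℝ (fderiv ℝ f) x (Pi.single k 1) (Pi.single l 1) := fun k l => by
    have := pd_clm (ContinuousLinearMap.apply ℝ F (Pi.single l 1 : Coord n)) hd k
    exact this
  rw [h, h]
  exact (hf.contDiffAt (hU.mem_nhds hx)).isSymmSndFDerivAt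
    (by simp only [minSmoothness_of_isRCLikeNormedField]; exact WithTop.coe_le_coe.2 (le_top : (2 : ℕ∞) ≤ ⊤)) _ _

/-- Parseval's identity for an adapted orthonormal frame. -/
theorem mink_eq_sum_frame [NeZero n] {E : Fin n → Ambient n} {e : NIdx n → Ambient n}
    (hE : ∀ i j, mink (E i) (E j) = if i = j then eps ℝ i else 0)
    (he : ∀ s t, mink (e s) (e t) = if s = t then 1 else 0)
    (heE : ∀ s i, mink (e s) (E i) = 0) (v w : Ambient n) :
    mink v w = ∑ i, eps ℝ i * mink v (E i) * mink w (E i) + ∑ s, mink v (e s) * mink w (e s) := by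
  set Φ : Matrix (Fin n ⊕ NIdx n) (Fin (2 * n - 1)) ℝ := Matrix.of (Sum.elim E e) with hΦ
  set D : Matrix (Fin n ⊕ NIdx n) (Fin n ⊕ NIdx n) ℝ :=
    Matrix.diagonal (Sum.elim (eps ℝ) fun _ => 1) with hD
  set η := J (2 * n - 1) ℝ with hη
  have hmink : ∀ v w : Ambient n, mink v w = v ⬝ᵥ (η *ᵥ w) := fun v w => by
    simp only [mink, hη, J, dotProduct, Matrix.mulVec_diagonal]
    exact Finset.sum_congr rfl fun i _ => by ring
  have hgram : Φ * η * Φᵀ = D := by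
    have h1 : ∀ a b, (Φ * η * Φᵀ) a b = mink (Sum.elim E e a) (Sum.elim E e b) := fun a b => by
      simp only [hη, J, Matrix.mul_apply (N := Φᵀ), Matrix.mul_diagonal, mink]
      exact Finset.sum_congr rfl fun i _ => by
        simp only [hΦ, Matrix.of_apply, Matrix.transpose_apply]; ring
    ext a b
    rw [h1, hD, Matrix.diagonal_apply]
    rcases a with a | a <;> rcases b with b | b
    · simp [hE]
    · simp [mink_comm (E a), heE]
    · simp [heE]
    · simp [he]
  have hDD : D * D = 1 := by
    rw [hD, Matrix.diagonal_mul_diagonal, ← Matrix.diagonal_one]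
    congr 1
    ext (a | a) <;> simp [eps_mul_self]
  have hcard : Fintype.card (Fin n ⊕ NIdx n) = Fintype.card (Fin (2 * n - 1)) := by
    have := NeZero.pos n
    simp [Fintype.card_subtype_compl]
    omega
  have hl : Φ * (η * Φᵀ * D) = 1 := by
    rw [← Matrix.mul_assoc, ← Matrix.mul_assoc, hgram, hDD]
  -- The frame has n + (n-1) = 2n-1 vectors, so the one-sided inverse given by orthonormality is
  -- two-sided; this is completeness.
  have hr := (Matrix.mul_eq_one_comm_of_equiv (Fintype.card_eq.1 hcard).some).1 hl
  have hcomplete : η = η * Φᵀ * D * Φ * η := by rw [hr, one_mul]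
  have hcoord : ∀ (v : Ambient n) a, (Φ *ᵥ (η *ᵥ v)) a = mink v (Sum.elim E e a) := fun v a => by
    rw [mink_comm, hmink]; rfl
  have hηt : ηᵀ = η := J_transpose _ _
  calc mink v w = v ⬝ᵥ ((η * Φᵀ * D * Φ * η) *ᵥ w) := by rw [hmink, ← hcomplete]
    _ = (Φ *ᵥ (η *ᵥ v)) ⬝ᵥ (D *ᵥ (Φ *ᵥ (η *ᵥ w))) := by
        rw [Matrix.mulVec_mulVec, Matrix.mulVec_mulVec, Matrix.mulVec_mulVec,
          ← Matrix.vecMul_transpose (Φ * η) v, ← Matrix.dotProduct_mulVec, Matrix.mulVec_mulVec,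
          Matrix.transpose_mul, hηt]
        simp only [Matrix.mul_assoc]
    _ = _ := by
        simp only [dotProduct, hD, Matrix.mulVec_diagonal, hcoord, Fintype.sum_sum_type,
          Sum.elim_inl, Sum.elim_inr, one_mul]
        congr 1
        exact Finset.sum_congr rfl fun i _ => by ring

variable [NeZero n] {X : Coord n → Ambient n} {e : NIdx n → Coord n → Ambient n}
  {A : Coord n → Matrix (Fin n) (Fin n) ℝ}

/-- Congruence with J makes the determinant of the diagonal metric nonzero. -/
theorem TimelikeSubmanifold.coeff_ne_zero (h : TimelikeSubmanifold U X e A) (hx : x ∈ U)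
    (i : Fin n) : A x 0 i ≠ 0 := by
  obtain ⟨P, -, hP⟩ := h.timelike x hx
  have hind : induced X x = Matrix.diagonal fun i => eps ℝ i * A x 0 i ^ 2 := by
    ext i j
    rw [Matrix.diagonal_apply]
    exact h.firstForm x hx i j
  have hJ : IsUnit (J n ℝ).det := Matrix.isUnit_det_of_left_inverse (J_mul_J n ℝ)
  rw [← hP, Matrix.det_mul, Matrix.det_mul, hind, Matrix.det_diagonal] at hJ
  have hprod := (mul_ne_zero_iff.1 (mul_ne_zero_iff.1 hJ.ne_zero).1).2
  have := Finset.prod_ne_zero_iff.1 hprod i (Finset.mem_univ i)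
  intro h0
  simp [h0] at this

theorem TimelikeSubmanifold.smooth_tangentFrame (hU : IsOpen U) (hA : SmoothMat U A)
    (h : TimelikeSubmanifold U X e A) (i : Fin n) : ContDiffOn ℝ ∞ (tangentFrame X A i) U :=
  ((hA 0 i).inv fun _ hx => h.coeff_ne_zero hx i).smul (contDiffOn_pd hU h.smoothX i)

theorem TimelikeSubmanifold.pd_eq_smul_tangentFrame (h : TimelikeSubmanifold U X e A) (hx : x ∈ U)
    (i : Fin n) : pd i X x = A x 0 i • tangentFrame X A i x := by
  rw [tangentFrame, smul_smul, mul_inv_cancel₀ (h.coeff_ne_zero hx i), one_smul]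

theorem TimelikeSubmanifold.mink_tangentFrame (h : TimelikeSubmanifold U X e A) (hx : x ∈ U)
    (i j : Fin n) :
    mink (tangentFrame X A i x) (tangentFrame X A j x) = if i = j then eps ℝ i else 0 := by
  rw [tangentFrame, tangentFrame, mink_smul_left, mink_smul_right, h.firstForm x hx]
  by_cases hij : i = j
  · subst hij
    have := h.coeff_ne_zero hx i
    simp only [if_true]
    field_simp
  · simp [hij]

theorem TimelikeSubmanifold.mink_normal_tangentFrame (h : TimelikeSubmanifold U X e A) (hx : x ∈ U)
    (s : NIdx n) (i : Fin n) : mink (e s x) (tangentFrame X A i x) = 0 := by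
  rw [tangentFrame, mink_smul_right, h.normal x hx, mul_zero]

theorem TimelikeSubmanifold.pd_pd_eq (hU : IsOpen U) (hA : SmoothMat U A)
    (h : TimelikeSubmanifold U X e A) (hx : x ∈ U) (k l : Fin n) :
    pd k (pd l X) x = pd k (fun y => A y 0 l) x • tangentFrame X A l x
      + A x 0 l • pd k (tangentFrame X A l) x := by
  rw [pd_congr hU hx (fun y hy => h.pd_eq_smul_tangentFrame hy l) k,
    pd_smul (hA.differentiableAt hU hx 0 l)
      (differentiableAt_of_smooth hU hx (h.smooth_tangentFrame hU hA l))]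

/-- Differentiating ∂_jX = a^1_j E_j, with E_j the unit tangent frame, the derivative of the
coefficient stays tangential; pairing with a normal and dividing by a^1_j gives ω^λ_j. -/
theorem TimelikeSubmanifold.mink_pd_tangentFrame_normal (hU : IsOpen U) (hA : SmoothMat U A)
    (h : TimelikeSubmanifold U X e A) (hx : x ∈ U) (s : NIdx n) (k j : Fin n) :
    mink (pd k (tangentFrame X A j) x) (e s x) = normalForm A s j x k := by
  have h1 := h.secondForm x hx s k j
  rw [h.pd_pd_eq hU hA hx, mink_add_left, mink_smul_left, mink_smul_left,
    mink_comm (tangentFrame X A j x), h.mink_normal_tangentFrame hx, mul_zero, zero_add] at h1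
  refine mul_left_cancel₀ (h.coeff_ne_zero hx j) (h1.trans ?_)
  unfold normalForm
  by_cases hkj : k = j
  · subst hkj; simp; ring
  · simp [hkj]

/-- Torsion is the tangential part of ∂_k∂_l X = ∂_l∂_k X. Gauss and Codazzi are the tangential and
normal parts of the same symmetry for the frame vectors, with products of first derivatives expanded
by Parseval. -/
theorem TimelikeSubmanifold.structureEquations (hU : IsOpen U) (hA : SmoothMat U A)
    (h : TimelikeSubmanifold U X e A) : GaussCodazzi U A (tangentConn X A) := by
  have hEs := h.smooth_tangentFrame hU hA
  have hEd : ∀ x ∈ U, ∀ i, DifferentiableAt ℝ (tangentFrame X A i) x := fun x hx i =>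
    differentiableAt_of_smooth hU hx (hEs i)
  have hed : ∀ x ∈ U, ∀ s, DifferentiableAt ℝ (e s) x := fun x hx s =>
    differentiableAt_of_smooth hU hx (h.smoothe s)
  have hpEd : ∀ x ∈ U, ∀ k i, DifferentiableAt ℝ (pd k (tangentFrame X A i)) x := fun x hx k i =>
    differentiableAt_of_smooth hU hx (contDiffOn_pd hU (hEs i) k)
  have hskew : ∀ x ∈ U, ∀ i j k, mink (pd k (tangentFrame X A i) x) (tangentFrame X A j x)
      = -mink (pd k (tangentFrame X A j) x) (tangentFrame X A i x) := by
    intro x hx i j k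
    have h1 := pd_mink (hEd x hx i) (hEd x hx j) k
    rw [pd_congr hU hx (fun y hy => h.mink_tangentFrame hy i j), pd_const,
      mink_comm (tangentFrame X A i x)] at h1
    linarith
  have hnormal : ∀ x ∈ U, ∀ s i k, mink (pd k (e s) x) (tangentFrame X A i x)
      = -normalForm A s i x k := by
    intro x hx s i k
    have h1 := pd_mink (hed x hx s) (hEd x hx i) k
    rw [pd_congr hU hx (fun y hy => h.mink_normal_tangentFrame hy s i), pd_const,
      mink_comm (e s x), h.mink_pd_tangentFrame_normal hU hA hx] at h1
    linarith
  have hframe : ∀ x ∈ U, ∀ v w : Ambient n, mink v w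
      = ∑ i, eps ℝ i * mink v (tangentFrame X A i x) * mink w (tangentFrame X A i x)
        + ∑ s, mink v (e s x) * mink w (e s x) := fun x hx =>
    mink_eq_sum_frame (h.mink_tangentFrame hx) (h.orthonormal x hx)
      (h.mink_normal_tangentFrame hx)
  refine ⟨fun k i j => contDiffOn_const.mul (contDiffOn_mink (contDiffOn_pd hU (hEs j) k) (hEs i)),
    fun x hx i k l => ?_, fun x hx i j k => ?_, fun x hx i j k l => ?_, fun x hx s i k l => ?_,
    fun x hx s t k l => Finset.sum_eq_zero fun j _ => ?_⟩
  · rw [torsion_iff]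
    have h1 := congrArg (fun v => eps ℝ i * mink v (tangentFrame X A i x))
      (pd_pd_comm hU h.smoothX hx k l)
    simp only [h.pd_pd_eq hU hA hx, mink_add_left, mink_smul_left, h.mink_tangentFrame hx] at h1
    simp only [firstCoeff, tangentConn, Matrix.of_apply]
    have hi := eps_mul_self ℝ i
    have hite : ∀ (m : Fin n) (c : ℝ), eps ℝ i * (c * if m = i then eps ℝ m else 0)
        = if i = m then c else 0 := fun m c => by
      by_cases hm : i = m
      · subst hm; simp; linear_combination c * hi
      · simp [hm, Ne.symm hm]
    rw [mul_add, mul_add, hite, hite] at h1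
    linear_combination h1
  · have hi := eps_mul_self ℝ i
    have hj := eps_mul_self ℝ j
    simp only [tangentConn, Matrix.of_apply]
    rw [hskew x hx i j k]
    linear_combination mink (pd k (tangentFrame X A j) x) (tangentFrame X A i x) * (hi - hj)
  · have hpd : ∀ p q : Fin n, pd p (fun y => tangentConn X A q y i j) x
        = eps ℝ i * (mink (pd p (pd q (tangentFrame X A j)) x) (tangentFrame X A i x)
          + mink (pd q (tangentFrame X A j) x) (pd p (tangentFrame X A i) x)) := fun p q => by
      rw [← pd_mink (hpEd x hx q j) (hEd x hx i)]
      exact pd_const_mul (differentiableAt_of_smooth hU hx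
        (contDiffOn_mink (contDiffOn_pd hU (hEs j) q) (hEs i))) _ _
    -- Parseval splits the product into connection terms and second fundamental form terms; skewness
    -- supplies the minus sign.
    have hexp : ∀ p q : Fin n,
        eps ℝ i * mink (pd q (tangentFrame X A j) x) (pd p (tangentFrame X A i) x)
        = -(∑ m, tangentConn X A p x i m * tangentConn X A q x m j)
          + ∑ s, eps ℝ i * normalForm A s i x p * normalForm A s j x q := fun p q => by
      rw [hframe x hx, mul_add, Finset.mul_sum, Finset.mul_sum, ← Finset.sum_neg_distrib]
      congr 1
      · refine Finset.sum_congr rfl fun m _ => ?_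
        simp only [tangentConn, Matrix.of_apply]
        rw [hskew x hx i m p]
        ring
      · refine Finset.sum_congr rfl fun s _ => ?_
        rw [h.mink_pd_tangentFrame_normal hU hA hx, h.mink_pd_tangentFrame_normal hU hA hx]
        ring
    simp only [extD, wedge, Finset.sum_sub_distrib, hpd, mul_add, hexp,
      pd_pd_comm hU (hEs j) hx k l, neg_mul, Finset.sum_neg_distrib]
    ring
  · have hpd : ∀ p q : Fin n, pd p (fun y => normalForm A s i y q) x
        = mink (pd p (pd q (tangentFrame X A i)) x) (e s x)
          + mink (pd q (tangentFrame X A i) x) (pd p (e s) x) := fun p q => by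
      rw [← pd_mink (hpEd x hx q i) (hed x hx s)]
      exact pd_congr hU hx (fun y hy => (h.mink_pd_tangentFrame_normal hU hA hy s q i).symm) p
    have hexp : ∀ p q : Fin n, mink (pd q (tangentFrame X A i) x) (pd p (e s) x)
        = -∑ m, normalForm A s m x p * tangentConn X A q x m i := fun p q => by
      rw [hframe x hx, ← Finset.sum_neg_distrib]
      -- A parallel normal frame has purely tangential derivatives, so only the tangential half of
      -- Parseval survives.
      have h0 : ∑ t, mink (pd q (tangentFrame X A i) x) (e t x) * mink (pd p (e s) x) (e t x) = 0 :=
        Finset.sum_eq_zero fun t _ => by rw [h.parallel x hx, mul_zero]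
      rw [h0, add_zero]
      refine Finset.sum_congr rfl fun m _ => ?_
      rw [hnormal x hx]
      simp only [tangentConn, Matrix.of_apply]
      ring
    simp only [extD, wedge, Finset.sum_sub_distrib, hpd, hexp, pd_pd_comm hU (hEs i) hx k l]
    ring
  · simp only [wedge, normalForm]
    split_ifs <;> simp

end Submanifold

end SinhG

end

theorem theoremT (n : ℕ) [NeZero n] (ε : ℝ) (hε₀ : 0 < ε) (hε₁ : ε < 1)
    (U : Set (SinhG.Coord n)) (hU : IsOpen U)
    (A : SinhG.Coord n → Matrix (Fin n) (Fin n) ℝ)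
    (hA : SinhG.SmoothMat U A) (hO : ∀ x ∈ U, A x ∈ SinhG.O1 n) :
    -- a submanifold with these fundamental forms gives a solution of all three systems
    (∀ (X : SinhG.Coord n → SinhG.Ambient n) (e : SinhG.NIdx n → SinhG.Coord n → SinhG.Ambient n),
      SinhG.TimelikeSubmanifold U X e A →
        SinhG.GaussCodazzi U A (SinhG.tangentConn X A) ∧
        SinhG.SolvesTwisted ε U A (SinhG.tangentConn X A) ∧
        ∃ F, SinhG.GenSinhGordon U A F ∧
          ∀ k, ∀ x ∈ U, SinhG.tangentConn X A k x = SinhG.connOf (F x) k) ∧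
    -- the Gauss-Codazzi and structure equations are the twisted system
    ((∀ x ∈ U, ∀ i, A x 0 i ≠ 0) →
      ∀ u : Fin n → SinhG.Coord n → Matrix (Fin n) (Fin n) ℝ,
        SinhG.GaussCodazzi U A u ↔ SinhG.SolvesTwisted ε U A u) ∧
    -- the twisted system is the generalized sinh-Gordon equation
    (∀ u : Fin n → SinhG.Coord n → Matrix (Fin n) (Fin n) ℝ,
      SinhG.SolvesTwisted ε U A u ↔
        ∃ F, SinhG.GenSinhGordon U A F ∧ ∀ k, ∀ x ∈ U, u k x = SinhG.connOf (F x) k) ∧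
    ((∃ u, SinhG.SolvesTwisted ε U A u) ↔ ∃ F, SinhG.GenSinhGordon U A F) := by
  open SinhG in
  have hlax : ∀ u : Fin n → Coord n → Matrix (Fin n) (Fin n) ℝ,
      SolvesTwisted ε U A u ↔ LaxSystem U A u := fun u =>
    ⟨fun h => h.laxSystem hε₀ hε₁ hU, fun h => h.solvesTwisted hε₀ hU hA hO⟩
  have hgc : ∀ u : Fin n → Coord n → Matrix (Fin n) (Fin n) ℝ,
      GaussCodazzi U A u ↔ LaxSystem U A u := fun u => gaussCodazzi_iff_laxSystem hU hA hO
  have hF : ∀ u : Fin n → Coord n → Matrix (Fin n) (Fin n) ℝ, LaxSystem U A u →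
      ∃ F, GenSinhGordon U A F ∧ ∀ k, ∀ x ∈ U, u k x = connOf (F x) k := fun u h =>
    ⟨offDiag u, h.genSinhGordon hU hA hO, fun k _ hx => h.eq_connOf hO k hx⟩
  refine ⟨fun X e h => ?_, fun _ u => (hgc u).trans (hlax u).symm,
    fun u => ⟨fun h => hF u ((hlax u).1 h),
      fun ⟨F, hFG, hu⟩ => (hlax u).2 (hFG.laxSystem hU hu)⟩,
    fun ⟨u, h⟩ => ?_, fun ⟨F, h⟩ => ⟨fun k x => connOf (F x) k,
      (hlax _).2 (h.laxSystem hU fun _ _ _ => rfl)⟩⟩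
  · have hg := h.structureEquations hU hA
    have hl := (hgc _).1 hg
    exact ⟨hg, (hlax _).2 hl, hF _ hl⟩
  · obtain ⟨F, hFG, -⟩ := hF u ((hlax u).1 h)
    exact ⟨F, hFG⟩
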